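/- **Setting.** Let $G$ be a discrete group and $X$ a $G$-simplicial set that is $G$-connected (every fixed point simplicial set $X^H$, $H\le G$, is connected), with a $G$-fixed vertex $v$. Let $O_G$ be the category of orbits $G/H$ ($H\le G$ any subgroup) and $G$-maps; $\hat g:G/H\to G/K$ denotes the $G$-map with $\hat g(eH)=gK$. Let $\Pi X$ be the category whose objects are the $G$-maps $x_H:G/H\to|X|$ (points of $|X|^H$), $H\le G$, and whose morphisms $x_H\to y_K$ are the pairs $[\hat g,\phi]$ of a $G$-map $\hat g:G/H\to G/K$ and a homotopy class rel end points of $G$-homotopies $\phi:G/H\times[0,1]\to|X|$ from $x_H$ to $y_K\circ\hat g$, composed by $[\hat g_2,\phi_2]\circ[\hat g_1,\phi_1]=[\hat g_2\circ\hat g_1,\ \phi_1\text{ followed by }\phi_2\circ\hat g_1]$. An equivariant local coefficient system $M$ is a functor $(\Pi X)^{op}\to Ab$. **Cohomology.** For an equivariant $n$-simplex $\sigma:G/H\times\Delta[n]\to X$ let $\sigma_H\in\Pi X$ be its initial vertex, $\sigma^{(j)}$ its $j$-th face and $\sigma_*:\sigma_H\to\sigma^{(0)}_H$ the morphism given by the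 edge joining its first two vertices. Let $S^n_G(X;M)$ be the group of functions $f$ with $f(\sigma)\in M(\sigma_H)$ for all equivariant $n$-simplices $\sigma$, $f(\sigma)=0$ for $\sigma$ degenerate, and $f(\tau\circ(\hat g\times id))=M([\hat g,\mathrm{const}])f(\tau)$ for all $\hat g$. With $(\delta f)(\sigma)=M(\sigma_*)f(\sigma^{(0)})+\sum_{j\ge1}(-1)^jf(\sigma^{(j)})$, put $H^n_G(X;M)=H^n(S^*_G(X;M),\delta)$. **Classifying object.** Let $v_H$ be the constant map $G/H\to|X|$ at $v$; put $\underline\pi(G/H)=\pi_1(X^H,v)$ with product $\alpha\beta=\alpha\circ\beta$ (first $\beta$, then $\alpha$), $M_0(G/H)=M(v_H)$, $M_0(\hat g)=M([\hat g,\mathrm{const}])$, and let $\alpha\in\pi_1(X^H,v)$ act on $M_0(G/H)$ by $\phi(\alpha)=M([id,\alpha])^{-1}$. Let $\overline W\underline\pi(G/H)$ be the $\overline W$-construction of the group $\underline\pi(G/H)$, with simplices $[g_1,\dots,g_q]$ and $\partial_0[g_1,\dots,g_q]=[g_2,\dots,g_q]$, $\partial_1[g_1,\dots,g_q]=[g_2g_1,g_3,\dots,g_q]$.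 Let $L_\phi(M_0,n)$ be the $O_G$-simplicial set with $L_\phi(M_0,n)(G/H)_q=Z^n(\Delta[q];M_0(G/H))\times\overline W\underline\pi(G/H)_q$ (normalized cocycles), whose face and degeneracy operators are componentwise except that $\partial_0(c,[g_1,\dots,g_q])=(g_1\cdot\partial_0c,\ \partial_0[g_1,\dots,g_q])$. Let $p:L_\phi(M_0,n)\to\overline W\underline\pi$ be the projection. **Twisting.** Choose for every vertex $x$ of $X$ a path $\omega_x$ in $|X|$ from $v$ to $x$, fixed pointwise by the stabilizer $G_x$, such that $\omega_{gx}=g\,\omega_x$ for all $g\in G$. For $y\in X^H_{m}$, $m\ge1$, with first two vertices $y_0,y_1$, let $\kappa(G/H)(y)=[\omega_{y_1}]^{-1}\circ[y_0y_1]\circ[\omega_{y_0}]\in\pi_1(X^H,v)$, where $[y_0y_1]$ is the class of the edge of $y$. Let $\Phi X$ be the $O_G$-simplicial set $G/H\mapsto X^H$, and let $\theta(\kappa):\Phi X\to\overline W\underline\pi$ be $x\mapsto[\kappa(x),\kappa(\partial_0x),\dots,\kappa(\partial_0^{q-1}x)]$ for $x\in X^H_q$. Two liftings $F,F':\Phi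 X\to L_\phi(M_0,n)$ of $\theta(\kappa)$ (so $pF=pF'=\theta(\kappa)$) are vertically homotopic if there is a map of $O_G$-simplicial sets $\Phi X\times\Delta[1]\to L_\phi(M_0,n)$ restricting to $F$ and $F'$ at the two ends and lying over $\theta(\kappa)\circ pr_1$. **Theorem 5.11.** Such a choice of paths $\omega$ exists. For every such choice and every $n\ge0$, vertical homotopy is an equivalence relation on the liftings of $\theta(\kappa)$, and there is a bijection $$H^n_G(X;M)\;\cong\;[\Phi X,L_\phi(M_0,n)]_{\overline W\underline\pi}$$ onto the set of vertical homotopy classes of liftings $\Phi X\to L_\phi(M_0,n)$ of $\theta(\kappa)$. It takes the class of a cocycle $f$ to the class of $F$ whenever, for every equivariant $n$-simplex $\sigma$ (of any type $H$), with $F(G/H)(\sigma(eH,\Delta_n))=(c,b)$, one has $c(\Delta_n)=M([id,\omega_{x}])\,f(\sigma)$, where $[id,\omega_x]:v_H\to\sigma_H$ is the morphism of $\Pi X$ given by the path to the initial vertex $x$ of $\sigma(eH,\Delta_n)$. -/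

import Mathlib

universe u

namespace EquivCoh

open CategoryTheory Simplicial Opposite MonoidalCategory

noncomputable section

/-! ### Orbit category, `G`-simplicial sets, equivariant simplices -/

section Orbits

variable {G : Type u} [Group G]

/-- The category `O_G` of canonical orbits: an object is a coset space `G/H`, recorded by the
subgroup `H`, and a morphism is a `G`-map. -/
structure OrbitCat (G : Type u) [Group G] where
  /-- the subgroup `H` of the orbit `G/H` -/
  H : Subgroup G

instance : Category (OrbitCat G) where
  Hom A B := (G ⧸ A.H) →[G] (G ⧸ B.H)
  id A := MulActionHom.id G
  comp f g := g.comp f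

/-- The coset `eH`. -/
abbrev eCoset (H : Subgroup G) : G ⧸ H := ((1 : G) : G ⧸ H)

/-- The coset `gK = ĝ (eH)` determining a morphism `ĝ : G/H → G/K`. -/
def OrbitCat.img {A B : OrbitCat G} (f : A ⟶ B) : G ⧸ B.H :=
  (show (G ⧸ A.H) →[G] (G ⧸ B.H) from f) (eCoset A.H)

/-- The set of `G`-maps `G/H → Y`.  Evaluation at `eH` identifies it with the fixed point set
`Y^H`. -/
def OrbitMap (H : Subgroup G) (Y : Type u) [MulAction G Y] : Type u := (G ⧸ H) →[G] Y

namespace OrbitMap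

variable {Y Z : Type u} [MulAction G Y] [MulAction G Z]

instance (H : Subgroup G) : FunLike (OrbitMap H Y) (G ⧸ H) Y :=
  inferInstanceAs (FunLike ((G ⧸ H) →[G] Y) _ _)

theorem map_smul {H : Subgroup G} (s : OrbitMap H Y) (g : G) (a : G ⧸ H) : s (g • a) = g • s a :=
  MulActionHom.map_smul (show (G ⧸ H) →[G] Y from s) g a

theorem apply_coe {H : Subgroup G} (s : OrbitMap H Y) (g : G) :
    s (g : G ⧸ H) = g • s (eCoset H) := by
  rw [← map_smul, MulAction.Quotient.smul_mk, smul_eq_mul, mul_one]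

theorem ext_one {H : Subgroup G} {s t : OrbitMap H Y} (h : s (eCoset H) = t (eCoset H)) :
    s = t := by
  apply DFunLike.coe_injective
  funext a
  obtain ⟨g, rfl⟩ := QuotientGroup.mk_surjective a
  rw [apply_coe s, apply_coe t, h]

/-- The topology making evaluation at `eH` a homeomorphism onto the subspace `Y^H` of `Y`. -/
instance (H : Subgroup G) [TopologicalSpace Y] : TopologicalSpace (OrbitMap H Y) :=
  TopologicalSpace.induced (fun s => s (eCoset H)) inferInstance

/-- Restriction along a morphism of orbits. -/
def pre {A B : OrbitCat G} (f : A ⟶ B) (s : OrbitMap B.H Y) : OrbitMap A.H Y :=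
  MulActionHom.comp (N := G) s f

/-- Composition with a `G`-map. -/
def post {H : Subgroup G} (f : Y →[G] Z) (s : OrbitMap H Y) : OrbitMap H Z :=
  MulActionHom.comp (M := G) f s

/-- The `G`-map `gH ↦ g y` determined by an `H`-fixed element `y`. -/
def ofFixed {H : Subgroup G} (y : Y) (hy : ∀ h ∈ H, h • y = y) : OrbitMap H Y where
  toFun a := Quotient.liftOn' a (fun g => g • y) (by
    intro g g' h
    have h1 := hy _ (QuotientGroup.leftRel_apply.mp h)
    change g • y = g' • y
    rw [mul_smul, inv_smul_eq_iff] at h1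
    exact h1.symm)
  map_smul' g a := by
    obtain ⟨b, rfl⟩ := QuotientGroup.mk_surjective a
    exact mul_smul g b y

theorem ofFixed_one {H : Subgroup G} (y : Y) (hy : ∀ h ∈ H, h • y = y) :
    ofFixed y hy (eCoset H) = y := one_smul G y

theorem fixed {H : Subgroup G} (s : OrbitMap H Y) (a : G ⧸ H) (h : G) (hh : h • a = a) :
    h • s a = s a := by
  rw [← map_smul, hh]

theorem fixed_one {H : Subgroup G} (s : OrbitMap H Y) (h : G) (hh : h ∈ H) :
    h • s (eCoset H) = s (eCoset H) := by
  apply fixed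
  rw [MulAction.Quotient.smul_mk, smul_eq_mul, mul_one]
  exact QuotientGroup.eq.mpr (by simpa using hh)

theorem fixed_pre {A B : OrbitCat G} (f : A ⟶ B) (s : OrbitMap B.H Y) (h : G) (hh : h ∈ A.H) :
    h • s (OrbitCat.img f) = s (OrbitCat.img f) :=
  fixed_one (s.pre f) h hh

/-- Restriction along a morphism of orbits is continuous. -/
def preC {A B : OrbitCat G} (f : A ⟶ B) (Y : Type u) [MulAction G Y] [TopologicalSpace Y]
    [ContinuousConstSMul G Y] : C(OrbitMap B.H Y, OrbitMap A.H Y) where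
  toFun := pre f
  continuous_toFun := by
    rw [continuous_induced_rng]
    obtain ⟨g, hg⟩ := QuotientGroup.mk_surjective (OrbitCat.img f)
    have : (fun s : OrbitMap A.H Y => s (eCoset A.H)) ∘ pre f =
        fun s : OrbitMap B.H Y => g • s (eCoset B.H) := by
      funext s
      change s (OrbitCat.img f) = _
      rw [← hg, apply_coe]
    rw [this]
    exact continuous_induced_dom.const_smul g

end OrbitMap

/-- A `G`-simplicial set is an object of `Action SSet G`; each set of simplices is a `G`-set. -/
instance (X : Action SSet.{u} G) (n : SimplexCategoryᵒᵖ) : MulAction G (X.V.obj n) where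
  smul g x := (X.ρ g : X.V ⟶ X.V).app n x
  one_smul x := by
    change (X.ρ 1 : X.V ⟶ X.V).app n x = x
    rw [map_one]; rfl
  mul_smul g h x := by
    change (X.ρ (g * h) : X.V ⟶ X.V).app n x = _
    rw [map_mul]; rfl

/-- The geometric realization `|X|` of a `G`-simplicial set. -/
abbrev Realiz (X : Action SSet.{u} G) : TopCat.{u} := SSet.toTop.obj X.V

instance (X : Action SSet.{u} G) : MulAction G (Realiz X) where
  smul g y := SSet.toTop.map (X.ρ g : X.V ⟶ X.V) y
  one_smul y := by
    change SSet.toTop.map (X.ρ 1 : X.V ⟶ X.V) y = y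
    rw [X.ρ_one, CategoryTheory.Functor.map_id]; rfl
  mul_smul g h y := by
    change SSet.toTop.map (X.ρ (g * h) : X.V ⟶ X.V) y = _
    have : (X.ρ (g * h) : X.V ⟶ X.V) = (X.ρ h : X.V ⟶ X.V) ≫ (X.ρ g : X.V ⟶ X.V) := by
      rw [map_mul]; rfl
    rw [this, CategoryTheory.Functor.map_comp]; rfl

instance (X : Action SSet.{u} G) : ContinuousConstSMul G (Realiz X) where
  continuous_const_smul g := (SSet.toTop.map (X.ρ g : X.V ⟶ X.V)).hom.continuous

/-- The simplicial operator of `X` belonging to `φ`, as a `G`-map. -/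
def opG (X : Action SSet.{u} G) {m n : ℕ} (φ : ⦋m⦌ ⟶ ⦋n⦌) : X.V _⦋n⦌ →[G] X.V _⦋m⦌ where
  toFun x := X.V.map φ.op x
  map_smul' g x := (NatTrans.naturality_apply (X.ρ g : X.V ⟶ X.V) φ.op x).symm

/-- The fixed point simplicial set `X^H`, as a subcomplex of `X`. -/
def fixedSub (X : Action SSet.{u} G) (H : Subgroup G) : X.V.Subcomplex where
  obj n := {x | ∀ h ∈ H, h • x = x}
  map φ x hx h hh := by
    have := NatTrans.naturality_apply (X.ρ h : X.V ⟶ X.V) φ x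
    change (X.ρ h : X.V ⟶ X.V).app _ (X.V.map φ x) = X.V.map φ x
    rw [this]
    exact congrArg (X.V.map φ) (hx h hh)

/-- `X` is `G`-connected: all fixed point simplicial sets are connected. -/
def GConnected (X : Action SSet.{u} G) : Prop :=
  ∀ H : Subgroup G, (fixedSub X H : SSet.{u}).IsConnected

/-- The equivariant simplex of type `H` (as a `G`-map `G/H → X_n`) of a simplex of `X^H`. -/
def eqSimplex {X : Action SSet.{u} G} {H : Subgroup G} {n : SimplexCategoryᵒᵖ}
    (x : (fixedSub X H : SSet.{u}).obj n) : OrbitMap H (X.V.obj n) :=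
  OrbitMap.ofFixed x.1 x.2

/-- The `O_G`-simplicial set `ΦX`, `G/H ↦ X^H`; a morphism `ĝ : G/H → G/K` with
`ĝ (eH) = gK` acts by `x ↦ g x`. -/
def Phi (X : Action SSet.{u} G) : (OrbitCat G)ᵒᵖ ⥤ SSet.{u} where
  obj A := fixedSub X A.unop.H
  map {B A} f :=
    { app n := ↾fun x => ⟨eqSimplex x (OrbitCat.img f.unop),
        OrbitMap.fixed_pre f.unop (eqSimplex x)⟩
      naturality n m φ := by
        ext x
        apply Subtype.ext
        obtain ⟨g, hg⟩ := QuotientGroup.mk_surjective (OrbitCat.img f.unop)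
        change eqSimplex _ (OrbitCat.img f.unop) =
          X.V.map φ (eqSimplex x (OrbitCat.img f.unop))
        rw [← hg]
        exact NatTrans.naturality_apply (X.ρ g : X.V ⟶ X.V) φ x.1 }
  map_id A := by
    ext n x
    apply Subtype.ext
    exact OrbitMap.ofFixed_one x.1 x.2
  map_comp {C B A} f g := by
    ext n x
    apply Subtype.ext
    change (eqSimplex x).pre f.unop (OrbitCat.img g.unop) = _
    apply congrArg (fun s : OrbitMap B.unop.H (X.V.obj n) => s (OrbitCat.img g.unop))
    apply OrbitMap.ext_one
    exact (OrbitMap.ofFixed_one (H := B.unop.H) (Y := X.V.obj n) _ _).symm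

/-- The equivariant simplex of `ĝ^* x` is the restriction of that of `x`. -/
theorem eqSimplex_Phi_map {X : Action SSet.{u} G} {A B : (OrbitCat G)ᵒᵖ} (f : B ⟶ A)
    {n : SimplexCategoryᵒᵖ} (x : ((Phi X).obj B).obj n) :
    eqSimplex (((Phi X).map f).app n x) = (eqSimplex x).pre f.unop := by
  apply OrbitMap.ext_one
  exact one_smul G _

end Orbits

/-! ### Points and paths in the realization -/

section Cells

/-- The characteristic map `Δⁿ → |X|` of a simplex. -/
def cell {X : SSet.{u}} {n : ℕ} (x : X _⦋n⦌) :
    C(stdSimplex ℝ (Fin (n + 1)), SSet.toTop.obj X) :=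
  TopCat.toSSetObjEquiv _ (op ⦋n⦌) ((sSetTopAdj.unit.app X).app (op ⦋n⦌) x)

theorem cell_map {X : SSet.{u}} {m n : ℕ} (φ : ⦋m⦌ ⟶ ⦋n⦌) (x : X _⦋n⦌)
    (s : stdSimplex ℝ (Fin (m + 1))) :
    cell (X.map φ.op x) s = cell x (stdSimplex.map φ s) := by
  have h := NatTrans.naturality_apply (sSetTopAdj.unit.app X) φ.op x
  unfold cell
  change TopCat.toSSetObjEquiv _ (op ⦋m⦌) ((sSetTopAdj.unit.app X).app (op ⦋m⦌) _) s = _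
  refine (congrArg (fun k => TopCat.toSSetObjEquiv _ (op ⦋m⦌) k s) h).trans ?_
  rfl

theorem map_cell {X Y : SSet.{u}} (f : X ⟶ Y) {n : ℕ} (x : X _⦋n⦌)
    (s : stdSimplex ℝ (Fin (n + 1))) :
    SSet.toTop.map f (cell x s) = cell (f.app _ x) s := by
  have h := sSetTopAdj.unit.naturality f
  have h' := congrArg (fun k => (k.app (op ⦋n⦌)) x) h
  unfold cell
  change _ = TopCat.toSSetObjEquiv _ (op ⦋n⦌) ((f ≫ sSetTopAdj.unit.app Y).app (op ⦋n⦌) x) s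
  have h2 : (f ≫ sSetTopAdj.unit.app Y).app (op ⦋n⦌) x = _ := h'
  rw [h2]
  rfl

/-- The point of `|X|` given by a `0`-simplex. -/
def pt {X : SSet.{u}} (x : X _⦋0⦌) : SSet.toTop.obj X := cell x (stdSimplex.vertex 0)

/-- The straight path from the `i`-th to the `j`-th vertex of `Δⁿ`. -/
def seg {n : ℕ} (i j : Fin (n + 1)) :
    Path (stdSimplex.vertex (S := ℝ) i) (stdSimplex.vertex (S := ℝ) j) where
  toFun t := ⟨AffineMap.lineMap (stdSimplex.vertex (S := ℝ) i).1
      (stdSimplex.vertex (S := ℝ) j).1 (t : ℝ),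
    (convex_stdSimplex ℝ (Fin (n + 1))).lineMap_mem (stdSimplex.vertex i).2
      (stdSimplex.vertex j).2 t.2⟩
  continuous_toFun := by
    apply Continuous.subtype_mk
    exact AffineMap.lineMap_continuous.comp continuous_subtype_val
  source' := by apply Subtype.ext; simp
  target' := by apply Subtype.ext; simp

end Cells

/-! ### The fundamental groupoid `ΠX` and equivariant local coefficients -/

section Groupoid

variable {G : Type u} [Group G]

/-- An object of `ΠX`: an orbit `G/H` and an equivariant `0`-simplex of type `H` of `S|X|`, that
is, a `G`-map `G/H → |X|` (a point of `|X|^H`). -/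
structure PiObj (X : Action SSet.{u} G) where
  /-- the orbit `G/H` -/
  orb : OrbitCat G
  /-- the `G`-map `G/H → |X|` -/
  pt : OrbitMap orb.H (Realiz X)

namespace PiObj

variable {X : Action SSet.{u} G}

/-- A morphism `x_H → y_K` of `ΠX`: a `G`-map `ĝ : G/H → G/K` together with the homotopy class,
relative to the end points, of a `G`-homotopy from `x_H` to `y_K ∘ ĝ`, that is, of a path in the
space of `G`-maps `G/H → |X|` (equivalently in `|X|^H`). -/
structure Hom (a b : PiObj X) where
  /-- the `G`-map `G/H → G/K` -/
  base : a.orb ⟶ b.orb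
  /-- the class of the path -/
  path : FundamentalGroupoid.mk a.pt ⟶ FundamentalGroupoid.mk (b.pt.pre base)

/-- The action of a morphism of orbits on classes of paths. -/
def pull {A B : OrbitCat G} (f : A ⟶ B) {x y : OrbitMap B.H (Realiz X)}
    (p : FundamentalGroupoid.mk x ⟶ FundamentalGroupoid.mk y) :
    FundamentalGroupoid.mk (x.pre f) ⟶ FundamentalGroupoid.mk (y.pre f) :=
  (FundamentalGroupoid.map (OrbitMap.preC f (Realiz X))).map p

theorem pull_refl {A B : OrbitCat G} (f : A ⟶ B) (x : OrbitMap B.H (Realiz X)) :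
    pull f (𝟙 (FundamentalGroupoid.mk x)) = 𝟙 _ := rfl

theorem pull_trans {A B : OrbitCat G} (f : A ⟶ B) {x y z : OrbitMap B.H (Realiz X)}
    (p : FundamentalGroupoid.mk x ⟶ FundamentalGroupoid.mk y)
    (q : FundamentalGroupoid.mk y ⟶ FundamentalGroupoid.mk z) :
    pull f (p ≫ q) = pull f p ≫ pull f q :=
  (FundamentalGroupoid.map (OrbitMap.preC f (Realiz X))).map_comp p q

theorem pull_id {A : OrbitCat G} {x y : OrbitMap A.H (Realiz X)}
    (p : FundamentalGroupoid.mk x ⟶ FundamentalGroupoid.mk y) : pull (𝟙 A) p = p := by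
  obtain ⟨p⟩ := p
  rfl

theorem pull_comp {A B C : OrbitCat G} (f : A ⟶ B) (g : B ⟶ C) {x y : OrbitMap C.H (Realiz X)}
    (p : FundamentalGroupoid.mk x ⟶ FundamentalGroupoid.mk y) :
    pull (f ≫ g) p = pull f (pull g p) := by
  obtain ⟨p⟩ := p
  rfl

/-- Composition: `(ĝ₂, φ₂) ∘ (ĝ₁, φ₁) = (ĝ₂ ∘ ĝ₁, φ₁ followed by φ₂ ∘ ĝ₁)`. -/
instance : Category (PiObj X) where
  Hom := Hom
  id a := ⟨𝟙 a.orb, 𝟙 (FundamentalGroupoid.mk a.pt)⟩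
  comp {_ _ _} f g := ⟨f.base ≫ g.base, f.path ≫ pull f.base g.path⟩
  id_comp {a b} f := by
    have h : 𝟙 (FundamentalGroupoid.mk a.pt) ≫ f.path = f.path := Category.id_comp _
    exact congrArg (fun p => (⟨f.base, p⟩ : Hom a b))
      ((congrArg (fun p => 𝟙 (FundamentalGroupoid.mk a.pt) ≫ p) (pull_id f.path)).trans h)
  comp_id {a b} f := congrArg (fun p => (⟨f.base, p⟩ : Hom a b)) (Category.comp_id f.path)
  assoc {a b c d} f g h := by
    have h1 : pull f.base (g.path ≫ pull g.base h.path) =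
        pull f.base g.path ≫ pull f.base (pull g.base h.path) := pull_trans _ _ _
    have h2 := (congrArg (fun p => f.path ≫ p) h1).trans (Category.assoc _ _ _).symm
    have h3 := pull_comp f.base g.base h.path
    exact congrArg (fun p => (⟨f.base ≫ g.base ≫ h.base, p⟩ : Hom a d))
      ((congrArg (fun p => (f.path ≫ pull f.base g.path) ≫ p) h3).trans h2.symm)

end PiObj

/-- An equivariant local coefficient system on `X`: a contravariant functor from `ΠX` to abelian
groups. -/
abbrev LocalCoeff (X : Action SSet.{u} G) := (PiObj X)ᵒᵖ ⥤ AddCommGrpCat.{u}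

variable {X : Action SSet.{u} G}

/-- The `i`-th vertex of an equivariant `n`-simplex, an equivariant `0`-simplex. -/
def vert {H : Subgroup G} {n : ℕ} (σ : OrbitMap H (X.V _⦋n⦌)) (i : Fin (n + 1)) :
    OrbitMap H (X.V _⦋0⦌) :=
  σ.post (opG X (SimplexCategory.const ⦋0⦌ ⦋n⦌ i))

/-- The `j`-th face of an equivariant simplex. -/
def face {H : Subgroup G} {n : ℕ} (σ : OrbitMap H (X.V _⦋n + 1⦌)) (j : Fin (n + 2)) :
    OrbitMap H (X.V _⦋n⦌) :=
  σ.post (opG X (SimplexCategory.δ j))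

/-- For `s ∈ Δⁿ`, the `G`-map `G/H → |X|` taking the point `s` in an equivariant `n`-simplex. -/
def cellMap {H : Subgroup G} {n : ℕ} (σ : OrbitMap H (X.V _⦋n⦌)) :
    C(stdSimplex ℝ (Fin (n + 1)), OrbitMap H (Realiz X)) where
  toFun s :=
    { toFun := fun a => cell (σ a) s
      map_smul' := fun g a => by
        rw [OrbitMap.map_smul]
        exact (map_cell (X.ρ g : X.V ⟶ X.V) (σ a) s).symm }
  continuous_toFun := continuous_induced_rng.mpr (cell (σ (eCoset H))).continuous

/-- An equivariant `0`-simplex of `X`, as a `G`-map `G/H → |X|`. -/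
def ptMap {H : Subgroup G} (s : OrbitMap H (X.V _⦋0⦌)) : OrbitMap H (Realiz X) :=
  cellMap s (stdSimplex.vertex 0)

theorem ptMap_vert {H : Subgroup G} {n : ℕ} (σ : OrbitMap H (X.V _⦋n⦌)) (i : Fin (n + 1)) :
    ptMap (vert σ i) = cellMap σ (stdSimplex.vertex i) := by
  apply OrbitMap.ext_one
  refine (cell_map (SimplexCategory.const ⦋0⦌ ⦋n⦌ i) (σ (eCoset H)) (stdSimplex.vertex 0)).trans ?_
  rw [stdSimplex.map_vertex]
  rfl

/-- The class, in the fundamental groupoid of the space of `G`-maps `G/H → |X|`, of the straight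
path along the edge from the `i`-th to the `j`-th vertex of an equivariant simplex. -/
def edge {H : Subgroup G} {n : ℕ} (σ : OrbitMap H (X.V _⦋n⦌)) (i j : Fin (n + 1)) :
    FundamentalGroupoid.mk (ptMap (vert σ i)) ⟶ FundamentalGroupoid.mk (ptMap (vert σ j)) :=
  Path.Homotopic.Quotient.mk
    (((seg i j).map (cellMap σ).continuous).cast (ptMap_vert σ i) (ptMap_vert σ j))

theorem seg_homotopic {n : ℕ} {x y : stdSimplex ℝ (Fin (n + 1))} (p q : Path x y) :
    p.Homotopic q := by
  have : ContractibleSpace (stdSimplex ℝ (Fin (n + 1))) :=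
    (convex_stdSimplex ℝ (Fin (n + 1))).contractibleSpace ⟨_, (stdSimplex.vertex 0).2⟩
  exact SimplyConnectedSpace.paths_homotopic p q

theorem map_seg {m n : ℕ} (φ : Fin (m + 1) → Fin (n + 1)) (i j : Fin (m + 1))
    (t : unitInterval) : stdSimplex.map φ (seg i j t) = seg (φ i) (φ j) t := by
  apply Subtype.ext
  change FunOnFinite.linearMap ℝ ℝ φ (AffineMap.lineMap (stdSimplex.vertex (S := ℝ) i).1
    (stdSimplex.vertex (S := ℝ) j).1 (t : ℝ)) = AffineMap.lineMap
    (stdSimplex.vertex (S := ℝ) (φ i)).1 (stdSimplex.vertex (S := ℝ) (φ j)).1 (t : ℝ)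
  rw [← stdSimplex.map_vertex φ i, ← stdSimplex.map_vertex φ j,
    AffineMap.lineMap_apply_module, AffineMap.lineMap_apply_module, map_add, map_smul, map_smul]
  rfl

theorem vert_op {H : Subgroup G} {m n : ℕ} (φ : ⦋m⦌ ⟶ ⦋n⦌) (σ : OrbitMap H (X.V _⦋n⦌))
    (i : Fin (m + 1)) : vert (σ.post (opG X φ)) i = vert σ (φ i) := by
  apply OrbitMap.ext_one
  change X.V.map _ (X.V.map _ _) = X.V.map _ _
  rw [← CategoryTheory.Functor.map_comp_apply, ← op_comp]
  rfl

theorem edge_refl {H : Subgroup G} {n : ℕ} (σ : OrbitMap H (X.V _⦋n⦌)) (i : Fin (n + 1)) :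
    edge σ i i = 𝟙 _ := by
  have h := ((seg_homotopic (seg i i) (Path.refl _)).map (cellMap σ)).pathCast
    (ptMap_vert σ i) (ptMap_vert σ i)
  refine (Path.Homotopic.Quotient.eq.mpr h).trans (congrArg _ ?_)
  ext t
  exact congrArg (fun s : OrbitMap H (Realiz X) => s) (ptMap_vert σ i).symm

theorem edge_comp {H : Subgroup G} {n : ℕ} (σ : OrbitMap H (X.V _⦋n⦌)) (i j k : Fin (n + 1)) :
    edge σ i j ≫ edge σ j k = edge σ i k := by
  have h := ((seg_homotopic ((seg i j).trans (seg j k)) (seg i k)).map (cellMap σ)).pathCast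
    (ptMap_vert σ i) (ptMap_vert σ k)
  refine Eq.trans ?_ (Path.Homotopic.Quotient.eq.mpr h)
  refine (Path.Homotopic.Quotient.mk_trans _ _).symm.trans (congrArg _ ?_)
  rw [Path.map_trans]
  rfl

end Groupoid

/-! ### Bredon–Illman cochains with local coefficients -/

section Cochains

variable {G : Type u} [Group G] {X : Action SSet.{u} G}

theorem vert_face {H : Subgroup G} {n : ℕ} (σ : OrbitMap H (X.V _⦋n + 1⦌)) (j : Fin (n + 2))
    (i : Fin (n + 1)) : vert (face σ j) i = vert σ (j.succAbove i) :=
  vert_op (SimplexCategory.δ j) σ i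

/-- An equivariant `n`-simplex `G/H × Δ[n] → X` of `X`, of some type `H`, recorded as a `G`-map
`G/H → X_n`. -/
structure EqSimp (X : Action SSet.{u} G) (n : ℕ) where
  /-- the orbit `G/H` -/
  orb : OrbitCat G
  /-- the `G`-map `G/H → X_n` -/
  map : OrbitMap orb.H (X.V _⦋n⦌)

namespace EqSimp

variable {n : ℕ}

/-- The simplex `σ(eH, Δ_n)` of `X^H` corresponding to an equivariant simplex `σ`. -/
def value (σ : EqSimp X n) : (fixedSub X σ.orb.H : SSet.{u}) _⦋n⦌ :=
  ⟨σ.map (eCoset σ.orb.H), fun h hh => OrbitMap.fixed_one σ.map h hh⟩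

/-- `σ` is degenerate if `σ(eH, Δ_n)` is. -/
def IsDegenerate (σ : EqSimp X n) : Prop :=
  σ.value ∈ (fixedSub X σ.orb.H : SSet.{u}).degenerate n

/-- The `j`-th face `σ^(j)`. -/
def face (σ : EqSimp X (n + 1)) (j : Fin (n + 2)) : EqSimp X n :=
  ⟨σ.orb, EquivCoh.face σ.map j⟩

/-- The object `σ_H` of `ΠX`: the initial vertex of `σ`. -/
def initial (σ : EqSimp X n) : PiObj X := ⟨σ.orb, ptMap (vert σ.map 0)⟩

theorem initial_face_zero (σ : EqSimp X (n + 1)) :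
    (⟨σ.orb, ptMap (vert σ.map 1)⟩ : PiObj X) = (σ.face 0).initial := by
  unfold initial face
  rw [vert_face]
  rfl

theorem initial_face_succ (σ : EqSimp X (n + 1)) (j : Fin (n + 1)) :
    σ.initial = (σ.face j.succ).initial := by
  unfold initial face
  rw [vert_face, Fin.succ_succAbove_zero]

/-- The morphism `σ_* : σ_H → σ^(0)_H` of `ΠX` given by the edge of `σ` between its first two
vertices. -/
def star (σ : EqSimp X (n + 1)) : σ.initial ⟶ (σ.face 0).initial :=
  (show σ.initial ⟶ (⟨σ.orb, ptMap (vert σ.map 1)⟩ : PiObj X) from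
    ⟨𝟙 σ.orb, edge σ.map 0 1⟩) ≫ eqToHom σ.initial_face_zero

/-- The equivariant simplex `τ ∘ (ĝ × id)`. -/
def pre {A : OrbitCat G} (τ : EqSimp X n) (f : A ⟶ τ.orb) : EqSimp X n := ⟨A, τ.map.pre f⟩

/-- The morphism `g_* : η_H → τ_K` of `ΠX` for `η = τ ∘ (ĝ × id)`: it is `ĝ` with a constant
path. -/
def preHom {A : OrbitCat G} (τ : EqSimp X n) (f : A ⟶ τ.orb) : (τ.pre f).initial ⟶ τ.initial :=
  ⟨f, 𝟙 (FundamentalGroupoid.mk (τ.pre f).initial.pt)⟩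

end EqSimp

variable (M : LocalCoeff X)

/-- All functions `f` on equivariant `n`-simplices with `f(σ) ∈ M(σ_H)`. -/
abbrev AllCochains (n : ℕ) : Type u := ∀ σ : EqSimp X n, M.obj (op σ.initial)

/-- The coboundary `(δf)(σ) = M(σ_*) f(σ^(0)) + ∑_{j ≥ 1} (-1)^j f(σ^(j))`; for `j ≥ 1` one has
`σ^(j)_H = σ_H`, and `eqToHom` is this identification. -/
def coboundary (n : ℕ) : AllCochains M n →+ AllCochains M (n + 1) where
  toFun f σ := M.map σ.star.op (f (σ.face 0)) +
    ∑ j : Fin (n + 1), (-1 : ℤ) ^ ((j : ℕ) + 1) •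
      M.map (eqToHom (σ.initial_face_succ j)).op (f (σ.face j.succ))
  map_zero' := by funext σ; simp
  map_add' f g := by
    funext σ
    simp only [Pi.add_apply, map_add, smul_add, Finset.sum_add_distrib]
    abel

/-- The group `S^n_G(X; M)`: the cochains that vanish on degenerate equivariant simplices and
satisfy `f(η) = M(g_*) f(τ)` whenever `η = τ ∘ (ĝ × id)`. -/
def SCochains (n : ℕ) : AddSubgroup (AllCochains M n) where
  carrier := {f | (∀ σ : EqSimp X n, σ.IsDegenerate → f σ = 0) ∧
    ∀ (τ : EqSimp X n) (A : OrbitCat G) (g : A ⟶ τ.orb),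
      f (τ.pre g) = M.map (τ.preHom g).op (f τ)}
  zero_mem' := ⟨fun _ _ => rfl, fun _ _ _ => by simp⟩
  add_mem' {f g} hf hg := ⟨fun σ h => by rw [Pi.add_apply, hf.1 σ h, hg.1 σ h, add_zero],
    fun τ A k => by rw [Pi.add_apply, Pi.add_apply, hf.2 τ A k, hg.2 τ A k, map_add]⟩
  neg_mem' {f} hf := ⟨fun σ h => by rw [Pi.neg_apply, hf.1 σ h, neg_zero],
    fun τ A k => by rw [Pi.neg_apply, Pi.neg_apply, hf.2 τ A k, map_neg]⟩

/-- The `n`-cocycles of `S^*_G(X; M)`. -/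
def SCocycles (n : ℕ) : AddSubgroup (AllCochains M n) := SCochains M n ⊓ (coboundary M n).ker

/-- The `n`-coboundaries of `S^*_G(X; M)`: zero for `n = 0`, and `δ(S^k_G(X; M))` for `n = k + 1`. -/
def SCoboundaries (n : ℕ) : AddSubgroup (AllCochains M n) :=
  Nat.casesOn (motive := fun n => AddSubgroup (AllCochains M n)) n ⊥
    (fun k => (SCochains M k).map (coboundary M k))

/-- The Bredon–Illman cohomology `H^n_G(X; M) = H^n(S^*_G(X; M))` with local coefficients. -/
abbrev BICohomology (n : ℕ) : Type u :=
  SCocycles M n ⧸ (SCoboundaries M n).addSubgroupOf (SCocycles M n)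

end Cochains

/-! ### `O_G`-groups and the generalized `O_G`-Eilenberg–MacLane complex -/

section EilenbergMacLane

variable {G : Type u} [Group G]

/-- An action of an `O_G`-group on an abelian `O_G`-group. -/
structure OAction (P : (OrbitCat G)ᵒᵖ ⥤ GrpCat.{u}) (A : (OrbitCat G)ᵒᵖ ⥤ AddCommGrpCat.{u}) where
  /-- the action of `P(G/H)` on `A(G/H)` by automorphisms -/
  act (H : (OrbitCat G)ᵒᵖ) : P.obj H →* AddMonoid.End (A.obj H)
  /-- naturality -/
  natural {K H : (OrbitCat G)ᵒᵖ} (f : K ⟶ H) (a : P.obj K) (m : A.obj K) :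
    act H (P.map f a) (A.map f m) = A.map f (act K a m)

/-- Functoriality of the bar construction in the group. -/
def wBarGrp : GrpCat.{u} ⥤ SSet.{u} where
  obj P := nerve (SingleObj P)
  map f := nerveMap f.hom.toFunctor

/-- `W̄P`, as the nerve of the one object groupoid `P`: a `q`-simplex `[g₁, …, g_q]` is a chain of
arrows `g₁, …, g_q`, and `∂₀[g₁, …, g_q] = [g₂, …, g_q]`, `∂₁[g₁, …, g_q] = [g₂g₁, …, g_q]`. -/
def WBar (P : (OrbitCat G)ᵒᵖ ⥤ GrpCat.{u}) : (OrbitCat G)ᵒᵖ ⥤ SSet.{u} := P ⋙ wBarGrp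

/-- The group element carried by the edge from the `i`-th to the `j`-th vertex of a simplex of
`W̄P`; for `[g₁, …, g_q]` it is `g_j ⋯ g_{i+1}`, so that the canonical twisting function
`κ(P)[g₁, …, g_q] = g₁` is the value on `0 ≤ 1`. -/
def barEdge {P : Type u} [Group P] {q : ℕ} (b : ComposableArrows (SingleObj P) q)
    {i j : Fin (q + 1)} (h : i ≤ j) : P :=
  b.map (homOfLE h)

theorem bar_ext {P : Type u} [Group P] {q : ℕ} {b b' : ComposableArrows (SingleObj P) q}
    (h : ∀ (i j : Fin (q + 1)) (hij : i ≤ j), barEdge b hij = barEdge b' hij) : b = b' := by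
  refine CategoryTheory.Functor.ext (fun _ => rfl) fun i j f => ?_
  refine Eq.trans ?_ (Category.id_comp (X := b.obj i) (Y := b.obj j) _).symm
  refine Eq.trans ?_ (Category.comp_id (X := b.obj i) (Y := b.obj j) _).symm
  exact h i j (leOfHom f)

/-- The group `C^n(Δ[q]; A)` of normalized cochains. -/
def simpCochains (A : Type u) [AddCommGroup A] (n q : ℕ) :
    AddSubgroup ((Δ[q] : SSet.{u}) _⦋n⦌ → A) where
  carrier := {c | ∀ α ∈ (Δ[q] : SSet.{u}).degenerate n, c α = 0}
  zero_mem' _ _ := rfl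
  add_mem' {c d} hc hd α h := by rw [Pi.add_apply, hc α h, hd α h, add_zero]
  neg_mem' {c} hc α h := by rw [Pi.neg_apply, hc α h, neg_zero]

/-- The group `K(A, n)_q = Z^n(Δ[q]; A)` of normalized cocycles. -/
def simpCocycles (A : Type u) [AddCommGroup A] (n q : ℕ) :
    AddSubgroup ((Δ[q] : SSet.{u}) _⦋n⦌ → A) where
  carrier := {c | c ∈ simpCochains A n q ∧ ∀ α : (Δ[q] : SSet.{u}) _⦋n + 1⦌,
    ∑ i : Fin (n + 2), (-1 : ℤ) ^ (i : ℕ) • c ((Δ[q] : SSet.{u}).δ i α) = 0}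
  zero_mem' := ⟨zero_mem _, fun α => by simp⟩
  add_mem' {c d} hc hd := ⟨add_mem hc.1 hd.1, fun α => by
    simp only [Pi.add_apply, smul_add, Finset.sum_add_distrib, hc.2 α, hd.2 α, add_zero]⟩
  neg_mem' {c} hc := ⟨neg_mem hc.1, fun α => by
    simp only [Pi.neg_apply, smul_neg, Finset.sum_neg_distrib, hc.2 α, neg_zero]⟩

/-- The simplicial operators of `K(A, n)` combined with a homomorphism of coefficients:
`c ↦ (α ↦ h (c (φ_* α)))`. -/
def pushCocycle {A B : Type u} [AddCommGroup A] [AddCommGroup B] (h : A →+ B) {n m q : ℕ}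
    (φ : ⦋m⦌ ⟶ ⦋q⦌) (c : simpCocycles A n q) : simpCocycles B n m :=
  ⟨fun α => h (c.1 ((SSet.stdSimplex.map φ).app (op ⦋n⦌) α)), by
    refine ⟨fun α hα => ?_, fun α => ?_⟩
    · change h _ = 0
      rw [c.2.1 _ (SSet.degenerate_app_apply hα (SSet.stdSimplex.map φ)), map_zero]
    · have := c.2.2 ((SSet.stdSimplex.map φ).app (op ⦋n + 1⦌) α)
      simp only [← map_zsmul, ← map_sum]
      refine (congrArg h ?_).trans (map_zero h)
      refine Eq.trans (Finset.sum_congr rfl fun i _ => ?_) this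
      congr 2⟩

theorem pushCocycle_comp {A B C : Type u} [AddCommGroup A] [AddCommGroup B] [AddCommGroup C]
    (h : A →+ B) (k : B →+ C) {n m p q : ℕ} (φ : ⦋m⦌ ⟶ ⦋q⦌) (ψ : ⦋p⦌ ⟶ ⦋m⦌)
    (c : simpCocycles A n q) :
    pushCocycle k ψ (pushCocycle h φ c) = pushCocycle (k.comp h) (ψ ≫ φ) c := rfl

theorem pushCocycle_id {A : Type u} [AddCommGroup A] {n q : ℕ} (c : simpCocycles A n q) :
    pushCocycle (1 : AddMonoid.End A) (𝟙 ⦋q⦌) c = c := by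
  apply Subtype.ext
  funext α
  have h : SSet.stdSimplex.{u}.map (𝟙 ⦋q⦌) = 𝟙 _ := CategoryTheory.Functor.map_id _ _
  exact congrArg (fun k => c.1 (k.app (op ⦋n⦌) α)) h

theorem barEdge_refl {P : Type u} [Group P] {q : ℕ} (b : ComposableArrows (SingleObj P) q)
    (i : Fin (q + 1)) : barEdge b (le_refl i) = 1 := b.map_id i

theorem barEdge_trans {P : Type u} [Group P] {q : ℕ} (b : ComposableArrows (SingleObj P) q)
    {i j k : Fin (q + 1)} (h : i ≤ j) (h' : j ≤ k) :
    barEdge b h' * barEdge b h = barEdge b (h.trans h') :=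
  (b.map_comp (homOfLE h) (homOfLE h')).symm

variable {P : (OrbitCat G)ᵒᵖ ⥤ GrpCat.{u}} {A : (OrbitCat G)ᵒᵖ ⥤ AddCommGrpCat.{u}}

/-- The twisted cartesian product `L_φ(A, n)(G/H) = K(A(G/H), n) ×_κ W̄P(G/H)`.  The operator of
`θ : [m] → [q]` is `(c, b) ↦ (a · θ^*c, θ^*b)`, where `a` is the group element carried by the edge
of `b` from `0` to `θ(0)`.  So `∂₀(c, b) = (κ(P)(b) ∂₀c, ∂₀b)`, and all the other face and
degeneracy operators act componentwise. -/
def LObj (φ : OAction P A) (n : ℕ) (H : (OrbitCat G)ᵒᵖ) : SSet.{u} where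
  obj k := simpCocycles (A.obj H) n k.unop.len × ComposableArrows (SingleObj (P.obj H)) k.unop.len
  map {k l} θ := ↾fun x =>
    (pushCocycle (φ.act H (barEdge x.2 (Fin.zero_le (θ.unop 0)))) θ.unop x.1,
      (nerve (SingleObj (P.obj H))).map θ x.2)
  map_id k := by
    apply ConcreteCategory.hom_ext; intro x
    refine Prod.ext ?_ rfl
    refine Eq.trans ?_ (pushCocycle_id x.1)
    exact congrArg (fun h => pushCocycle h (𝟙 _) x.1) ((congrArg (φ.act H) (barEdge_refl _ _)).trans
      (map_one _))
  map_comp {k l m} θ ψ := by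
    apply ConcreteCategory.hom_ext; intro x
    refine Prod.ext ?_ rfl
    refine Eq.trans ?_ (pushCocycle_comp _ _ _ _ _).symm
    refine congrArg (fun h => pushCocycle h (ψ.unop ≫ θ.unop) x.1) ?_
    refine Eq.trans ?_ ((φ.act H).map_mul _ _)
    refine congrArg (φ.act H) ?_
    exact (barEdge_trans x.2 _ (θ.unop.toOrderHom.monotone (Fin.zero_le (ψ.unop 0)))).symm

/-- `L_φ(A, n)` as an `O_G`-simplicial set, the generalized `O_G`-Eilenberg–MacLane complex. -/
def LComplex (φ : OAction P A) (n : ℕ) : (OrbitCat G)ᵒᵖ ⥤ SSet.{u} where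
  obj H := LObj φ n H
  map {H K} f :=
    { app k := ↾fun x => (pushCocycle (A.map f).hom (𝟙 _) x.1,
        (((WBar P).map f).app k) x.2)
      naturality k l θ := by
        apply ConcreteCategory.hom_ext; intro x
        refine Prod.ext ?_ rfl
        refine (pushCocycle_comp _ _ _ _ _).trans (Eq.trans ?_ (pushCocycle_comp _ _ _ _ _).symm)
        refine congrArg (fun h => pushCocycle h θ.unop x.1) ?_
        ext m
        exact (φ.natural f (barEdge x.2 (Fin.zero_le (θ.unop 0))) m).symm }
  map_id H := by
    apply NatTrans.ext; funext k
    apply ConcreteCategory.hom_ext; intro x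
    refine Prod.ext ?_ ?_
    · refine Eq.trans ?_ (pushCocycle_id x.1)
      refine congrArg (fun h => pushCocycle h (𝟙 _) x.1) ?_
      rw [A.map_id]; rfl
    · change ((WBar P).map (𝟙 H)).app k x.2 = x.2
      rw [CategoryTheory.Functor.map_id]; rfl
  map_comp {H K L} f g := by
    apply NatTrans.ext; funext k
    apply ConcreteCategory.hom_ext; intro x
    refine Prod.ext ?_ ?_
    · refine Eq.trans ?_ (pushCocycle_comp _ _ _ _ _).symm
      refine congrArg (fun h => pushCocycle h (𝟙 _) x.1) ?_
      rw [A.map_comp]; rfl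
    · change ((WBar P).map (f ≫ g)).app k x.2 = _
      rw [CategoryTheory.Functor.map_comp]; rfl

/-- The projection `p : L_φ(A, n) → W̄P`. -/
def LProj (φ : OAction P A) (n : ℕ) : LComplex φ n ⟶ WBar P where
  app H := { app k := ↾fun x => x.2 }

end EilenbergMacLane

/-! ### The data attached to a fixed vertex -/

section Based

variable {G : Type u} [Group G] {X : Action SSet.{u} G}

/-- A `G`-fixed vertex of `X`. -/
structure FixedVertex (X : Action SSet.{u} G) where
  /-- the vertex -/
  v : X.V _⦋0⦌
  fixed : ∀ g : G, g • v = v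

namespace FixedVertex

variable (v : FixedVertex X)

/-- The fixed vertex as an equivariant `0`-simplex of type `H`. -/
def const (H : Subgroup G) : OrbitMap H (X.V _⦋0⦌) where
  toFun _ := v.v
  map_smul' g _ := (v.fixed g).symm

/-- The fixed vertex as a `G`-map `G/H → |X|`. -/
def base (H : Subgroup G) : OrbitMap H (Realiz X) := ptMap (v.const H)

theorem base_pre {A B : OrbitCat G} (f : A ⟶ B) : (v.base B.H).pre f = v.base A.H := rfl

/-- The functor `O_G → ΠX`, `G/H ↦ v_H`; it sends `ĝ` to `[ĝ, k]` with `k` constant. -/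
def functor : OrbitCat G ⥤ PiObj X where
  obj A := ⟨A, v.base A.H⟩
  map {A _} f := ⟨f, 𝟙 (FundamentalGroupoid.mk (v.base A.H))⟩
  map_id _ := rfl
  map_comp {A B C} f g := by
    refine congrArg (fun p => (⟨f ≫ g, p⟩ : PiObj.Hom ⟨A, v.base A.H⟩ ⟨C, v.base C.H⟩)) ?_
    exact (Category.comp_id (𝟙 (FundamentalGroupoid.mk (v.base A.H)))).symm

/-- The `O_G`-group `G/H ↦ π₁(X^H, v)`.  The product `αβ` of two classes of loops is the composite
`α ∘ β` in the fundamental groupoid (first `β`, then `α`). -/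
def piGroup : (OrbitCat G)ᵒᵖ ⥤ GrpCat.{u} where
  obj A := GrpCat.of (FundamentalGroup (OrbitMap A.unop.H (Realiz X)) (v.base A.unop.H))
  map {B _} f := GrpCat.ofHom
    (FundamentalGroup.map (OrbitMap.preC f.unop (Realiz X)) (v.base B.unop.H))
  map_id A := by
    apply ConcreteCategory.hom_ext
    intro a
    exact PiObj.pull_id a
  map_comp {C B A} f g := by
    apply ConcreteCategory.hom_ext
    intro a
    exact PiObj.pull_comp g.unop f.unop a

/-- The abelian `O_G`-group `M₀`, `G/H ↦ M(v_H)`. -/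
def M₀ (M : LocalCoeff X) : (OrbitCat G)ᵒᵖ ⥤ AddCommGrpCat.{u} := v.functor.op ⋙ M

/-- The endomorphism `b(α) = [id, α]` of `v_H` in `ΠX` given by `α ∈ π₁(X^H, v)`. -/
def loopHom (A : OrbitCat G) (a : FundamentalGroup (OrbitMap A.H (Realiz X)) (v.base A.H)) :
    v.functor.obj A ⟶ v.functor.obj A :=
  ⟨𝟙 A, a⟩

theorem loopHom_one (A : OrbitCat G) : v.loopHom A 1 = 𝟙 _ := rfl

theorem loopHom_mul (A : OrbitCat G)
    (a b : FundamentalGroup (OrbitMap A.H (Realiz X)) (v.base A.H)) :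
    v.loopHom A (a * b) = v.loopHom A b ≫ v.loopHom A a := by
  refine congrArg (fun p => (⟨𝟙 A, p⟩ : PiObj.Hom (v.functor.obj A) (v.functor.obj A))) ?_
  exact congrArg (fun p => CategoryStruct.comp (X := FundamentalGroupoid.mk (v.base A.H))
    (Y := FundamentalGroupoid.mk (v.base A.H)) b p) (PiObj.pull_id a).symm

theorem functor_map_loopHom {A B : OrbitCat G} (f : A ⟶ B)
    (a : FundamentalGroup (OrbitMap B.H (Realiz X)) (v.base B.H)) :
    v.functor.map f ≫ v.loopHom B a =
      v.loopHom A (FundamentalGroup.map (OrbitMap.preC f (Realiz X)) (v.base B.H) a) ≫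
        v.functor.map f := by
  refine congrArg (fun p => (⟨f, p⟩ : PiObj.Hom (v.functor.obj A) (v.functor.obj B))) ?_
  refine (Category.id_comp (PiObj.pull f a)).trans ?_
  exact (Category.comp_id (PiObj.pull f a)).symm

/-- The action of `π₁(X^H, v)` on `M₀(G/H)`, `α · m = M(b(α))⁻¹ m`. -/
def action (M : LocalCoeff X) : OAction v.piGroup (v.M₀ M) where
  act A :=
    { toFun := fun a => (M.map (v.loopHom A.unop (a⁻¹ :
        FundamentalGroup (OrbitMap A.unop.H (Realiz X)) (v.base A.unop.H))).op).hom
      map_one' := by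
        have h : v.loopHom A.unop (1⁻¹ : FundamentalGroup _ _) = 𝟙 _ := by
          rw [inv_one, loopHom_one]
        refine (congrArg (fun k => (M.map k.op).hom) h).trans ?_
        rw [op_id, CategoryTheory.Functor.map_id]
        rfl
      map_mul' := fun a b => by
        have h : v.loopHom A.unop ((show FundamentalGroup _ _ from a) *
            (show FundamentalGroup _ _ from b))⁻¹ = v.loopHom A.unop
            ((show FundamentalGroup _ _ from a)⁻¹) ≫ v.loopHom A.unop
            ((show FundamentalGroup _ _ from b)⁻¹) := by
          rw [mul_inv_rev, loopHom_mul]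
        refine (congrArg (fun k => (M.map k.op).hom) h).trans ?_
        rw [op_comp, CategoryTheory.Functor.map_comp]
        rfl }
  natural {B A} f a m := by
    have h := v.functor_map_loopHom f.unop (show FundamentalGroup _ _ from a)⁻¹
    rw [map_inv] at h
    have h2 := congrArg (fun k => (M.map k.op) m) h
    simp only [op_comp, CategoryTheory.Functor.map_comp] at h2
    exact h2.symm

end FixedVertex

/-- A choice of paths used to define the twisting function: for every vertex `x` of `X` a path
`ω_x` in `|X|` from `v` to `x`, running in the fixed points of the stabilizer of `x`, such that
`ω_{gx} = g ω_x`. -/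
structure PathSystem (v : FixedVertex X) where
  /-- the path `ω_x` -/
  path (x : X.V _⦋0⦌) : Path (pt v.v : Realiz X) (pt x)
  fixed (x : X.V _⦋0⦌) (g : G) (hg : g • x = x) (t : unitInterval) : g • path x t = path x t
  equivariant (g : G) (x : X.V _⦋0⦌) (t : unitInterval) : path (g • x) t = g • path x t

namespace PathSystem

variable {v : FixedVertex X} (ω : PathSystem v)

/-- The class `ξ_H(x)` of `ω_x` in the fundamental groupoid of `X^H`, for a vertex `x` of `X^H`. -/
def xi {H : Subgroup G} (x : OrbitMap H (X.V _⦋0⦌)) :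
    FundamentalGroupoid.mk (v.base H) ⟶ FundamentalGroupoid.mk (ptMap x) :=
  Path.Homotopic.Quotient.mk
    { toFun := fun t =>
        { toFun := fun a => ω.path (x a) t
          map_smul' := fun g a => by
            rw [OrbitMap.map_smul]
            exact ω.equivariant g (x a) t }
      continuous_toFun := continuous_induced_rng.mpr (ω.path (x (eCoset H))).continuous
      source' := OrbitMap.ext_one (ω.path (x (eCoset H))).source
      target' := OrbitMap.ext_one (ω.path (x (eCoset H))).target }

/-- The loop `ξ(x_j)⁻¹ ∘ [x_i x_j] ∘ ξ(x_i)` at `v`, where `[x_i x_j]` is the edge of a simplex of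
`X^H` joining its vertices `x_i` and `x_j`. -/
def loop {H : Subgroup G} {n : ℕ} (σ : OrbitMap H (X.V _⦋n⦌)) (i j : Fin (n + 1)) :
    FundamentalGroup (OrbitMap H (Realiz X)) (v.base H) :=
  ω.xi (vert σ i) ≫ edge σ i j ≫ Groupoid.inv (ω.xi (vert σ j))

theorem loop_refl {H : Subgroup G} {n : ℕ} (σ : OrbitMap H (X.V _⦋n⦌)) (i : Fin (n + 1)) :
    ω.loop σ i i = 1 := by
  unfold loop
  rw [edge_refl, Category.id_comp, Groupoid.comp_inv]
  rfl

theorem loop_comp {H : Subgroup G} {n : ℕ} (σ : OrbitMap H (X.V _⦋n⦌)) (i j k : Fin (n + 1)) :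
    ω.loop σ j k * ω.loop σ i j = ω.loop σ i k := by
  unfold loop
  rw [End.mul_def, ← edge_comp σ i j k]
  simp

/-- The twisting function `κ(G/H)(y) = ξ(y_1)⁻¹ ∘ [y_0 y_1] ∘ ξ(y_0)`, for `y ∈ X^H_{n+1}` with
first two vertices `y_0`, `y_1`. -/
def kappa (H : (OrbitCat G)ᵒᵖ) {n : ℕ} (y : ((Phi X).obj H) _⦋n + 1⦌) : v.piGroup.obj H :=
  ω.loop (eqSimplex y) 0 1

theorem loop_congr {H : Subgroup G} {x y x' y' : OrbitMap H (X.V _⦋0⦌)} (hx : x = x') (hy : y = y')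
    (e : FundamentalGroupoid.mk (ptMap x) ⟶ FundamentalGroupoid.mk (ptMap y))
    (e' : FundamentalGroupoid.mk (ptMap x') ⟶ FundamentalGroupoid.mk (ptMap y')) (h : e ≍ e') :
    ω.xi x ≫ e ≫ Groupoid.inv (ω.xi y) = ω.xi x' ≫ e' ≫ Groupoid.inv (ω.xi y') := by
  subst hx hy
  rw [eq_of_heq h]

theorem loop_op {H : Subgroup G} {m n : ℕ} (φ : ⦋m⦌ ⟶ ⦋n⦌) (σ : OrbitMap H (X.V _⦋n⦌))
    (i j : Fin (m + 1)) : ω.loop (σ.post (opG X φ)) i j = ω.loop σ (φ i) (φ j) := by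
  refine ω.loop_congr (vert_op φ σ i) (vert_op φ σ j) _ _ ?_
  refine Path.Homotopic.hpath_hext fun t => ?_
  change cellMap (σ.post (opG X φ)) (seg i j t) = cellMap σ (seg (φ i) (φ j) t)
  rw [← map_seg]
  exact OrbitMap.ext_one (cell_map φ (σ (eCoset H)) (seg i j t))

theorem loop_pre {A B : OrbitCat G} (f : A ⟶ B) {n : ℕ} (σ : OrbitMap B.H (X.V _⦋n⦌))
    (i j : Fin (n + 1)) : ω.loop (σ.pre f) i j =
      FundamentalGroup.map (OrbitMap.preC f (Realiz X)) (v.base B.H) (ω.loop σ i j) := by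
  have h1 := PiObj.pull_trans f (ω.xi (vert σ i)) (edge σ i j ≫ Groupoid.inv (ω.xi (vert σ j)))
  have h2 := PiObj.pull_trans f (edge σ i j) (Groupoid.inv (ω.xi (vert σ j)))
  have h3 : PiObj.pull f (Groupoid.inv (ω.xi (vert σ j))) =
      Groupoid.inv (ω.xi (vert (σ.pre f) j)) := rfl
  rw [h2, h3] at h1
  exact h1.symm

/-- The simplex `[κ(x), κ(∂₀x), …, κ(∂₀^{q-1}x)]` of `W̄π`; its edge from the `i`-th to the `j`-th
vertex carries the loop of the edge of `x` from `x_i` to `x_j`. -/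
def thetaSimplex {H : Subgroup G} {q : ℕ} (σ : OrbitMap H (X.V _⦋q⦌)) :
    ComposableArrows (SingleObj (FundamentalGroup (OrbitMap H (Realiz X)) (v.base H))) q where
  obj _ := SingleObj.star _
  map {i j} _ := ω.loop σ i j
  map_id i := ω.loop_refl σ i
  map_comp {i j l} _ _ := (ω.loop_comp σ i j l).symm

/-- The map `θ(κ) : ΦX → W̄π`, `x ↦ [κ(x), κ(∂₀x), …, κ(∂₀^{q-1}x)]`. -/
def theta : Phi X ⟶ WBar v.piGroup where
  app H :=
    { app k := ↾fun x => ω.thetaSimplex (q := k.unop.len) (eqSimplex x)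
      naturality k l φ := by
        apply ConcreteCategory.hom_ext; intro x
        refine bar_ext (P := v.piGroup.obj H) (q := l.unop.len) fun i j _ => ?_
        have h1 : eqSimplex (((Phi X).obj H).map φ x) =
            (eqSimplex x).post (opG X (m := l.unop.len) (n := k.unop.len) φ.unop) := by
          apply OrbitMap.ext_one
          refine (one_smul G _).trans ?_
          exact (congrArg (X.V.map φ) (one_smul G _)).symm
        have h2 := ω.loop_op (m := l.unop.len) (n := k.unop.len) φ.unop (eqSimplex x) i j
        rw [← h1] at h2
        exact h2 }
  naturality {B A} f := by
    apply NatTrans.ext; funext k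
    apply ConcreteCategory.hom_ext; intro x
    refine bar_ext (P := v.piGroup.obj A) (q := k.unop.len) fun i j _ => ?_
    have h2 := ω.loop_pre (n := k.unop.len) f.unop (eqSimplex x) i j
    rw [← eqSimplex_Phi_map f x] at h2
    exact h2

/-- `κ(π) ∘ θ(κ) = κ`. -/
theorem barEdge_theta (H : (OrbitCat G)ᵒᵖ) {n : ℕ} (y : ((Phi X).obj H) _⦋n + 1⦌) :
    barEdge (q := n + 1) ((ω.theta.app H).app _ y) (Fin.zero_le 1) = ω.kappa H y := rfl

end PathSystem

/-! ### Liftings and vertical homotopy -/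

variable (v : FixedVertex X) (M : LocalCoeff X) (ω : PathSystem v)

/-- The liftings `ΦX → L_φ(M₀, n)` of `θ(κ)`. -/
def Lifting (n : ℕ) : Type u :=
  {F : Phi X ⟶ LComplex (v.action M) n // F ≫ LProj (v.action M) n = ω.theta}

/-- The cylinder `ΦX × Δ[1]`, `G/H ↦ X^H × Δ[1]`. -/
abbrev PhiCyl (X : Action SSet.{u} G) : (OrbitCat G)ᵒᵖ ⥤ SSet.{u} := Phi X ⋙ tensorRight Δ[1]

/-- The projection `ΦX × Δ[1] → ΦX`. -/
def cylFst (X : Action SSet.{u} G) : PhiCyl X ⟶ Phi X where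
  app H := SemiCartesianMonoidalCategory.fst ((Phi X).obj H) Δ[1]

/-- Two liftings are vertically homotopic if there is a homotopy `ΦX × Δ[1] → L_φ(M₀, n)` between
them lying over `θ(κ) ∘ pr₁`. -/
def VerticallyHomotopic (n : ℕ) (F F' : Lifting v M ω n) : Prop :=
  ∃ K : PhiCyl X ⟶ LComplex (v.action M) n,
    (∀ H, SSet.ι₀ ≫ K.app H = F.1.app H) ∧ (∀ H, SSet.ι₁ ≫ K.app H = F'.1.app H) ∧
    K ≫ LProj (v.action M) n = cylFst X ≫ ω.theta

/-- The set `[ΦX, L_φ(M₀, n)]_{W̄π}` of vertical homotopy classes of liftings of `θ(κ)`. -/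
abbrev VerticalClasses (n : ℕ) : Type u := Quot (VerticallyHomotopic v M ω n)

/-- The value `c(Δ_n)` of the fundamental cochain of `L_φ(A, n)` on an `n`-simplex `(c, b)`. -/
def fundamental {P : (OrbitCat G)ᵒᵖ ⥤ GrpCat.{u}} {A : (OrbitCat G)ᵒᵖ ⥤ AddCommGrpCat.{u}}
    (φ : OAction P A) (n : ℕ) (H : (OrbitCat G)ᵒᵖ) (x : ((LComplex φ n).obj H) _⦋n⦌) : A.obj H :=
  (show simpCocycles (A.obj H) n n × ComposableArrows (SingleObj (P.obj H)) n from x).1.1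
    (SSet.stdSimplex.objEquiv.symm (𝟙 _))

/-- The morphism `bξ_H(σ_H) : v_H → σ_H` of `ΠX` from the fixed vertex to the initial vertex of
an equivariant simplex, given by the chosen path. -/
def xiHom {n : ℕ} (σ : EqSimp X n) : v.functor.obj σ.orb ⟶ σ.initial :=
  ⟨𝟙 σ.orb, ω.xi (vert σ.map 0)⟩

end Based

end

end EquivCoh

namespace EquivCoh

open CategoryTheory Simplicial Opposite MonoidalCategory

noncomputable section

/-! ### The prism sum -/

/-! Both sides of the bijection are compared with twisted cochains on `ΦX`.

Transport along the paths `ω` identifies the coefficients at every initial vertex with those at `v`.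
Because `ω` is equivariant, an equivariant cochain becomes a family of normalized cochains on the
fixed point sets `X^H` with values in `M₀(G/H)`, natural in the orbit (`toFixedVertex`). Only the
zeroth face moves the initial vertex. Going out along `ω`, across the first edge and back along `ω`
is the loop `κ`, so the coboundary of `S^*_G(X; M)` becomes the alternating sum of faces in which
the zeroth face is twisted by the inverse action of `κ` (`toFixedVertex_coboundary`).

A lifting `F` of `θ` is determined by its fundamental cochain, the values `c(Δ_n)` on `n`-simplices:
compatibility with an operator `α : [n] → [q]` forces the value at `α` of the cocycle attached to a
`q`-simplex `x` to be the value on `α^* x`, transported back along the edge of `x` from `0` to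
`α(0)`. These transported values form an ordinary cocycle of `Δ[q]` for every `x` exactly when the
cochain is a twisted cocycle. Hence liftings correspond to twisted `n`-cocycles
(`pullFundamental_mem`, `lifting_ext`, `liftOfCocycle`). This holds for any `O_G`-simplicial set
over `W̄P`, in particular for the cylinder, so a vertical homotopy is a twisted cocycle on `ΦX ×
Δ[1]`.

By the prism operator, the two ends of such a cocycle differ by a coboundary (`sum_twistedD_prism`).
Conversely, if two cocycles differ by `dw`, extend `w` by zero from one end of the cylinder and add
the coboundary of the extension to the pullback of the first cocycle; the result restricts to the
two given cocycles. So liftings are vertically homotopic if and only if their cocycles are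
cohomologous (`verticallyHomotopic_iff`), which gives the equivalence relation and the bijection
together.

For the existence of `ω`, connectedness of the fixed point set of the stabilizer supplies a fixed
path to one vertex in each orbit, and `G` carries it to the rest of the orbit. -/

/-- Here `a i j` stands for the `j`-th face of the `i`-th prism and `b i j` for the `i`-th prism on
the `j`-th face. Faces off the two diagonals match terms of `b` after one index shifts by one, which
flips the sign; the diagonal faces are shared by neighbouring prisms and telescope to the two ends.
-/
theorem sum_range_prism {E : Type*} [AddCommGroup E] (N : ℕ) (a b : ℕ → ℕ → E)
    (h₁ : ∀ i j, i < N → j ≤ i → a (i + 1) j = b i j)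
    (h₂ : ∀ i, i < N → a (i + 1) (i + 1) = a i (i + 1))
    (h₃ : ∀ i j, i < N → i < j → j ≤ N → a i (j + 1) = b i j) :
    ∑ i ∈ Finset.range (N + 1), ∑ j ∈ Finset.range (N + 2), (-1 : ℤ) ^ (i + j) • a i j =
      a 0 0 - a N (N + 1) -
        ∑ i ∈ Finset.range N, ∑ j ∈ Finset.range (N + 1), (-1 : ℤ) ^ (i + j) • b i j := by
  -- Each row is cut into `j < i`, the two diagonal entries `j = i` and `j = i + 1`, and `j ≥ i +
  -- 2`.
  have row : ∀ i ∈ Finset.range (N + 1),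
      ∑ j ∈ Finset.range (N + 2), (-1 : ℤ) ^ (i + j) • a i j =
        ∑ j ∈ Finset.range i, (-1 : ℤ) ^ (i + j) • a i j + (a i i - a i (i + 1)) +
        ∑ k ∈ Finset.range (N - i), (-1 : ℤ) ^ (i + (i + 2 + k)) • a i (i + 2 + k) := by
    intro i hi
    have hi' : i ≤ N := by simpa [Nat.lt_succ_iff] using hi
    have e : N + 2 = (i + 2) + (N - i) := by omega
    rw [e, Finset.sum_range_add, Finset.sum_range_succ, Finset.sum_range_succ]
    congr 1
    rw [← add_assoc i i 1, pow_succ, Even.neg_one_pow ⟨i, rfl⟩]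
    simp only [one_smul, one_mul, neg_smul]
    abel
  have brow : ∀ i ∈ Finset.range N,
      ∑ j ∈ Finset.range (N + 1), (-1 : ℤ) ^ (i + j) • b i j =
        ∑ j ∈ Finset.range (i + 1), (-1 : ℤ) ^ (i + j) • b i j +
        ∑ k ∈ Finset.range (N - i), (-1 : ℤ) ^ (i + (i + 1 + k)) • b i (i + 1 + k) := by
    intro i hi
    have hi' : i < N := by simpa using hi
    have e : N + 1 = (i + 1) + (N - i) := by omega
    rw [e, Finset.sum_range_add]
  rw [Finset.sum_congr rfl row, Finset.sum_congr rfl brow, Finset.sum_add_distrib,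
    Finset.sum_add_distrib, Finset.sum_add_distrib]
  have lower : ∑ i ∈ Finset.range (N + 1), ∑ j ∈ Finset.range i, (-1 : ℤ) ^ (i + j) • a i j =
      -∑ i ∈ Finset.range N, ∑ j ∈ Finset.range (i + 1), (-1 : ℤ) ^ (i + j) • b i j := by
    rw [Finset.sum_range_succ', Finset.range_zero, Finset.sum_empty, add_zero,
      ← Finset.sum_neg_distrib]
    refine Finset.sum_congr rfl fun i hi => ?_
    rw [← Finset.sum_neg_distrib]
    refine Finset.sum_congr rfl fun j hj => ?_
    rw [h₁ i j (by simpa using hi) (by simpa [Nat.lt_succ_iff] using hj), ← neg_smul]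
    congr 1
    ring
  have upper : ∑ i ∈ Finset.range (N + 1), ∑ k ∈ Finset.range (N - i),
      (-1 : ℤ) ^ (i + (i + 2 + k)) • a i (i + 2 + k) =
      -∑ i ∈ Finset.range N, ∑ k ∈ Finset.range (N - i),
        (-1 : ℤ) ^ (i + (i + 1 + k)) • b i (i + 1 + k) := by
    rw [Finset.sum_range_succ, Nat.sub_self, Finset.range_zero, Finset.sum_empty, add_zero,
      ← Finset.sum_neg_distrib]
    refine Finset.sum_congr rfl fun i hi => ?_
    rw [← Finset.sum_neg_distrib]
    refine Finset.sum_congr rfl fun k hk => ?_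
    have hi' : i < N := by simpa using hi
    have hk' : k < N - i := by simpa using hk
    rw [← h₃ i (i + 1 + k) hi' (by omega) (by omega), ← neg_smul,
      show i + 1 + k + 1 = i + 2 + k by omega]
    congr 1
    ring
  -- By `h₂` the sum telescopes over `i < N`. The row `i = N` is split off because it has no
  -- successor to be glued to.
  have diag : ∑ i ∈ Finset.range (N + 1), (a i i - a i (i + 1)) = a 0 0 - a N (N + 1) := by
    rw [Finset.sum_range_succ,
      Finset.sum_congr rfl fun i hi => by rw [← h₂ i (by simpa using hi)],
      Finset.sum_range_sub']
    abel
  rw [lower, upper, diag]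
  abel

theorem sum_prism {E : Type*} [AddCommGroup E] {N : ℕ} (a : Fin (N + 1) → Fin (N + 2) → E)
    (b : Fin N → Fin (N + 1) → E)
    (h₁ : ∀ (i : Fin N) (j : Fin (N + 1)), j ≤ i.castSucc → a i.succ j.castSucc = b i j)
    (h₂ : ∀ i : Fin N, a i.succ i.castSucc.succ = a i.castSucc i.castSucc.succ)
    (h₃ : ∀ (i : Fin N) (j : Fin (N + 1)), i.castSucc < j → a i.castSucc j.succ = b i j) :
    ∑ i : Fin (N + 1), (-1 : ℤ) ^ (i : ℕ) •
        ∑ j : Fin (N + 2), (-1 : ℤ) ^ (j : ℕ) • a i j =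
      a 0 0 - a (Fin.last N) (Fin.last (N + 1)) -
        ∑ i : Fin N, (-1 : ℤ) ^ (i : ℕ) • ∑ j : Fin (N + 1), (-1 : ℤ) ^ (j : ℕ) • b i j := by
  -- Extension by zero to natural indices; every index that occurs below is in range, so the default
  -- is never used.
  let a' : ℕ → ℕ → E := fun i j =>
    if h : i < N + 1 ∧ j < N + 2 then a ⟨i, h.1⟩ ⟨j, h.2⟩ else 0
  let b' : ℕ → ℕ → E := fun i j => if h : i < N ∧ j < N + 1 then b ⟨i, h.1⟩ ⟨j, h.2⟩ else 0
  have ha : ∀ i j, ∀ hi : i < N + 1, ∀ hj : j < N + 2, a' i j = a ⟨i, hi⟩ ⟨j, hj⟩ :=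
    fun i j hi hj => dif_pos ⟨hi, hj⟩
  have hb : ∀ i j, ∀ hi : i < N, ∀ hj : j < N + 1, b' i j = b ⟨i, hi⟩ ⟨j, hj⟩ :=
    fun i j hi hj => dif_pos ⟨hi, hj⟩
  have key := sum_range_prism N a' b'
    (fun i j hi hj => by
      rw [ha _ _ (by omega) (by omega), hb _ _ hi (by omega)]
      exact h₁ ⟨i, hi⟩ ⟨j, by omega⟩ hj)
    (fun i hi => by
      rw [ha _ _ (by omega) (by omega), ha _ _ (by omega) (by omega)]
      exact h₂ ⟨i, hi⟩)
    (fun i j hi hj hj' => by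
      rw [ha _ _ (by omega) (by omega), hb _ _ hi (by omega)]
      exact h₃ ⟨i, hi⟩ ⟨j, by omega⟩ hj)
  simp only [Finset.sum_range, pow_add, mul_smul, ← Finset.smul_sum] at key
  rw [ha 0 0 (by omega) (by omega), ha N (N + 1) (by omega) (by omega)] at key
  refine Eq.trans ?_ (key.trans ?_)
  · exact Finset.sum_congr rfl fun i _ => congrArg _ (Finset.sum_congr rfl fun j _ =>
      congrArg _ (ha i j i.2 j.2).symm)
  · refine congrArg₂ _ rfl ?_
    exact Finset.sum_congr rfl fun i _ => congrArg _ (Finset.sum_congr rfl fun j _ =>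
      congrArg _ (hb i j i.2 j.2))

/-- The double sum over the faces of faces vanishes. -/
theorem sum_face_face {E : Type*} [AddCommGroup E] {N : ℕ} (a : Fin (N + 2) → Fin (N + 1) → E)
    (h : ∀ i j : Fin (N + 1), i ≤ j → a j.succ i = a i.castSucc j) :
    ∑ i : Fin (N + 2), (-1 : ℤ) ^ (i : ℕ) •
      ∑ j : Fin (N + 1), (-1 : ℤ) ^ (j : ℕ) • a i j = 0 := by
  simp only [Finset.smul_sum, ← Finset.sum_product', Finset.univ_product_univ]
  -- The pairs `i ≤ j` are matched with the remaining ones by `(i, j) ↦ (j + 1, i)`: the hypothesis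
  -- equates the two terms, and the signs are opposite.
  let S : Finset (Fin (N + 2) × Fin (N + 1)) := {ij | ij.1 ≤ ij.2.castSucc}
  rw [← Finset.sum_add_sum_compl S, ← eq_neg_iff_add_eq_zero, ← Finset.sum_neg_distrib]
  have hS : ∀ ij, ij ∈ S ↔ ij.1 ≤ ij.2.castSucc := fun ij => by simp [S]
  refine Finset.sum_bij (fun ij hij => (ij.2.succ, Fin.castLT ij.1
    (lt_of_le_of_lt ((hS ij).mp hij) ij.2.is_lt))) ?_ ?_ ?_ ?_
  · intro ij hij
    have := (hS ij).mp hij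
    rw [Finset.mem_compl, hS]
    simp only [Fin.le_def, Fin.val_succ, Fin.val_castSucc, Fin.val_castLT] at this ⊢
    omega
  · rintro ⟨i, j⟩ hij ⟨i', j'⟩ hij' e
    simp only [Prod.mk.injEq, Fin.ext_iff, Fin.val_succ, Fin.val_castLT] at e ⊢
    omega
  · rintro ⟨i, j⟩ hij
    rw [Finset.mem_compl, hS] at hij
    simp only [Fin.le_def, Fin.val_castSucc] at hij
    obtain ⟨i, rfl⟩ := Fin.exists_succ_eq.mpr (show i ≠ 0 by rintro rfl; simp at hij)
    refine ⟨(j.castSucc, i), (hS _).mpr ?_, rfl⟩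
    simp only [Fin.le_def, Fin.val_castSucc, Fin.val_succ] at hij ⊢
    omega
  · rintro ⟨i, j⟩ hij
    have hij' := (hS _).mp hij
    obtain ⟨i, rfl⟩ := Fin.exists_castSucc_eq.mpr
      (Fin.ne_of_lt (lt_of_le_of_lt hij' (Fin.castSucc_lt_last j)))
    have e := h i j (by simpa using hij')
    dsimp only
    rw [Fin.castLT_castSucc, e, smul_smul, smul_smul, ← neg_smul, Fin.val_succ, Fin.val_castSucc]
    congr 1
    ring

/-! ### The prism decomposition of a cylinder -/

/-- The prism decomposition of the cylinder `S × Δ[1]`, a simplicial homotopy between the two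
ends. -/
def prism (S : SSet.{u}) :
    SimplicialObject.Homotopy (SSet.ι₀ : S ⟶ S ⊗ Δ[1]) (SSet.ι₁ : S ⟶ S ⊗ Δ[1]) :=
  SSet.Homotopy.toSimplicialObjectHomotopy (f := SSet.ι₀) (g := SSet.ι₁)
    { h := 𝟙 _
      h₀ := Category.comp_id _
      h₁ := Category.comp_id _
      -- The homotopy is relative to the empty subcomplex, so there is no simplex to check.
      rel := by
        apply NatTrans.ext; funext n
        apply ConcreteCategory.hom_ext; intro x
        exact x.1.2.elim }

/-- The twist on the cylinder is pulled back along this projection, so the group elements on a prism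
are those of a degeneracy of `x`. -/
theorem prism_fst {S : SSet.{u}} {n : ℕ} (i : Fin (n + 1)) (x : S _⦋n⦌) :
    (SemiCartesianMonoidalCategory.fst S Δ[1]).app _ ((prism S).h i x) = S.σ i x := by
  change (SSet.yonedaEquiv.symm x).app _ (SSet.prodStdSimplex.nonDegenerateEquiv₁.{u} i).1.1 = _
  simp
  rfl

theorem prism_naturality {S T : SSet.{u}} (f : S ⟶ T) {n : ℕ} (i : Fin (n + 1)) (x : S _⦋n⦌) :
    (prism T).h i (f.app _ x) = (f ▷ Δ[1]).app _ ((prism S).h i x) := by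
  change (SSet.yonedaEquiv.symm (f.app _ x) ▷ Δ[1]).app _ _ =
    (f ▷ Δ[1]).app _ ((SSet.yonedaEquiv.symm x ▷ Δ[1]).app _ _)
  exact congrArg (fun k => (k ▷ Δ[1]).app _ (SSet.prodStdSimplex.nonDegenerateEquiv₁.{u} i).1)
    (SSet.yonedaEquiv_symm_comp x f).symm

-- From here on prisms enter only through the homotopy identities, the projection and naturality.
attribute [irreducible] prism

/-! ### Twisted cochains of a simplicial set over a bar construction -/

section Twisted

variable {P A : Type u} [Group P] [AddCommGroup A] (ρ : P →* AddMonoid.End A)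
  {S : SSet.{u}} (b : S ⟶ nerve (SingleObj P))

theorem act_act_inv (g : P) (a : A) : ρ g (ρ g⁻¹ a) = a := by
  have h : ρ g * ρ g⁻¹ = 1 := by rw [← map_mul, mul_inv_cancel, map_one]
  exact DFunLike.congr_fun h a

theorem act_inv_act (g : P) (a : A) : ρ g⁻¹ (ρ g a) = a := by
  have h : ρ g⁻¹ * ρ g = 1 := by rw [← map_mul, inv_mul_cancel, map_one]
  exact DFunLike.congr_fun h a

/-- The group element carried by the edge of `b(x)` from the `i`-th to the `j`-th vertex. -/
def edgeElt {q : ℕ} (x : S _⦋q⦌) {i j : Fin (q + 1)} (h : i ≤ j) : P :=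
  barEdge (q := q) (b.app _ x) h

theorem edgeElt_refl {q : ℕ} (x : S _⦋q⦌) (i : Fin (q + 1)) : edgeElt b x (le_refl i) = 1 :=
  barEdge_refl (q := q) _ i

theorem edgeElt_mul {q : ℕ} (x : S _⦋q⦌) {i j k : Fin (q + 1)} (h : i ≤ j) (h' : j ≤ k) :
    edgeElt b x h' * edgeElt b x h = edgeElt b x (h.trans h') :=
  barEdge_trans (q := q) _ h h'

theorem edgeElt_map {m n : ℕ} (φ : ⦋m⦌ ⟶ ⦋n⦌) (x : S _⦋n⦌) {i j : Fin (m + 1)} (h : i ≤ j) :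
    edgeElt b (S.map φ.op x) h = edgeElt b x (φ.toOrderHom.monotone h) := by
  have e := NatTrans.naturality_apply b φ.op x
  exact congrArg (fun c : ComposableArrows (SingleObj P) m => barEdge c h) e

theorem edgeElt_congr {q : ℕ} (x : S _⦋q⦌) {i j i' j' : Fin (q + 1)}
    (h : i ≤ j) (h' : i' ≤ j') (hi : i = i') (hj : j = j') :
    edgeElt b x h = edgeElt b x h' := by
  subst hi hj; rfl

/-- The value of a cochain on the `j`-th face of `x`, transported to the initial vertex of `x`. -/
def twistedFace {n : ℕ} (c : S _⦋n⦌ → A) (j : Fin (n + 2)) (x : S _⦋n + 1⦌) : A :=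
  ρ (edgeElt b x (Fin.zero_le (j.succAbove 0)))⁻¹ (c (S.δ j x))

/-- The twisted coboundary. -/
def twistedD {n : ℕ} (c : S _⦋n⦌ → A) (x : S _⦋n + 1⦌) : A :=
  ∑ j : Fin (n + 2), (-1 : ℤ) ^ (j : ℕ) • twistedFace ρ b c j x

/-- The value of a cochain on `α^* x`, transported to the initial vertex of `x`. -/
def transport {n q : ℕ} (c : S _⦋n⦌ → A) (x : S _⦋q⦌) (α : ⦋n⦌ ⟶ ⦋q⦌) : A :=
  ρ (edgeElt b x (Fin.zero_le (α 0)))⁻¹ (c (S.map α.op x))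

/-- The edge from `0` to `α(β(0))` factors through `α(0)`. The same factorization makes the
operators of `L_φ(A, n)` functorial, and it underlies both `d² = 0` and the naturality of liftings.
-/
theorem transport_comp {n m q : ℕ} (c : S _⦋n⦌ → A) (x : S _⦋q⦌) (α : ⦋m⦌ ⟶ ⦋q⦌) (β : ⦋n⦌ ⟶ ⦋m⦌) :
    transport ρ b c x (β ≫ α) =
      ρ (edgeElt b x (Fin.zero_le (α 0)))⁻¹ (transport ρ b c (S.map α.op x) β) := by
  have e : edgeElt b x (Fin.zero_le ((β ≫ α) 0)) =
      edgeElt b (S.map α.op x) (Fin.zero_le (β 0)) * edgeElt b x (Fin.zero_le (α 0)) := by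
    rw [edgeElt_map]
    exact (edgeElt_mul b x _ _).symm
  unfold transport
  rw [e, mul_inv_rev, map_mul, op_comp, Functor.map_comp_apply]
  rfl

theorem act_transport_comp {n m q : ℕ} (c : S _⦋n⦌ → A) (x : S _⦋q⦌) (α : ⦋m⦌ ⟶ ⦋q⦌)
    (β : ⦋n⦌ ⟶ ⦋m⦌) :
    ρ (edgeElt b x (Fin.zero_le (α 0))) (transport ρ b c x (β ≫ α)) =
      transport ρ b c (S.map α.op x) β := by
  rw [transport_comp, act_act_inv]

theorem transport_id {n : ℕ} (c : S _⦋n⦌ → A) (x : S _⦋n⦌) : transport ρ b c x (𝟙 _) = c x := by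
  unfold transport
  rw [op_id, Functor.map_id_apply]
  have e : edgeElt b x (Fin.zero_le ((𝟙 ⦋n⦌ : ⦋n⦌ ⟶ ⦋n⦌) 0)) = 1 := edgeElt_refl b x 0
  rw [e, inv_one, map_one]
  rfl

theorem twistedFace_eq {n : ℕ} (c : S _⦋n⦌ → A) (j : Fin (n + 2)) (x : S _⦋n + 1⦌)
    {k : Fin (n + 2)} (hk : k = j.succAbove 0) {y : S _⦋n⦌} (hy : y = S.δ j x) :
    twistedFace ρ b c j x = ρ (edgeElt b x (Fin.zero_le k))⁻¹ (c y) := by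
  subst hk hy; rfl

theorem twistedFace_succ {n : ℕ} (c : S _⦋n⦌ → A) (j : Fin (n + 1)) (x : S _⦋n + 1⦌) :
    twistedFace ρ b c j.succ x = c (S.δ j.succ x) := by
  rw [twistedFace_eq ρ b c j.succ x (Fin.succ_succAbove_zero j).symm rfl, edgeElt_refl, inv_one,
    map_one]
  rfl

theorem twistedD_eq {n : ℕ} (c : S _⦋n⦌ → A) (x : S _⦋n + 1⦌) :
    twistedD ρ b c x = twistedFace ρ b c 0 x +
      ∑ j : Fin (n + 1), (-1 : ℤ) ^ ((j : ℕ) + 1) • c (S.δ j.succ x) := by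
  unfold twistedD
  rw [Fin.sum_univ_succ, Fin.val_zero, pow_zero, one_smul]
  simp only [twistedFace_succ, Fin.val_succ]

theorem twistedFace_comp {T : SSet.{u}} (f : T ⟶ S) {n : ℕ} (c : S _⦋n⦌ → A) (j : Fin (n + 2))
    (x : T _⦋n + 1⦌) :
    twistedFace ρ (f ≫ b) (fun y => c (f.app _ y)) j x = twistedFace ρ b c j (f.app _ x) :=
  congrArg (fun y => ρ (edgeElt b (f.app _ x) (Fin.zero_le (j.succAbove 0)))⁻¹ (c y))
    (SSet.δ_naturality_apply f j x)

theorem twistedD_comp {T : SSet.{u}} (f : T ⟶ S) {n : ℕ} (c : S _⦋n⦌ → A) (x : T _⦋n + 1⦌) :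
    twistedD ρ (f ≫ b) (fun y => c (f.app _ y)) x = twistedD ρ b c (f.app _ x) :=
  Finset.sum_congr rfl fun j _ => congrArg _ (twistedFace_comp ρ b f c j x)

theorem twistedFace_twistedFace {n : ℕ} (c : S _⦋n⦌ → A) (i : Fin (n + 3)) (j : Fin (n + 2))
    (x : S _⦋n + 2⦌) : twistedFace ρ b (twistedFace ρ b c j) i x =
      transport ρ b c x (SimplexCategory.δ j ≫ SimplexCategory.δ i) :=
  (transport_comp ρ b c x (SimplexCategory.δ i) (SimplexCategory.δ j)).symm

/-- An iterated twisted face depends only on the composite coface operator, so the usual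
cancellation of double faces applies despite the twist. -/
theorem twistedD_twistedD {n : ℕ} (c : S _⦋n⦌ → A) (x : S _⦋n + 2⦌) :
    twistedD ρ b (twistedD ρ b c) x = 0 := by
  refine Eq.trans ?_ (sum_face_face
    (fun i j => transport ρ b c x (SimplexCategory.δ j ≫ SimplexCategory.δ i)) fun i j h =>
      congrArg (transport ρ b c x) (SimplexCategory.δ_comp_δ h))
  refine Finset.sum_congr rfl fun i _ => congrArg _ ?_
  refine (map_sum (ρ _) _ _).trans (Finset.sum_congr rfl fun j _ => ?_)
  exact (map_zsmul (ρ _) _ _).trans (congrArg _ (twistedFace_twistedFace ρ b c i j x))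

/-! ### Normalization of twisted cochains. -/

theorem map_mem_degenerate {m q : ℕ} (α : ⦋m⦌ ⟶ ⦋q⦌) (hα : ¬ Function.Injective α.toOrderHom)
    (x : S _⦋q⦌) : S.map α.op x ∈ S.degenerate m := by
  cases m with
  | zero => exact absurd (Function.injective_of_subsingleton (α := Fin 1) _) hα
  | succ m =>
    obtain ⟨i, β, rfl⟩ := SimplexCategory.eq_σ_comp_of_not_injective α hα
    rw [op_comp, Functor.map_comp_apply]
    exact SSet.σ_mem_degenerate _ _ _

theorem twistedFace_σ {n : ℕ} (c : S _⦋n⦌ → A) (j : Fin (n + 2)) (k : Fin (n + 1)) (y : S _⦋n⦌) :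
    twistedFace ρ b c j (S.σ k y) =
      transport ρ b c y (SimplexCategory.δ j ≫ SimplexCategory.σ k) := by
  refine (act_transport_comp ρ b c y (SimplexCategory.σ k) (SimplexCategory.δ j)).symm.trans ?_
  have e : edgeElt b y (Fin.zero_le ((SimplexCategory.σ k : ⦋n + 1⦌ ⟶ ⦋n⦌) 0)) = 1 :=
    (edgeElt_congr b y _ (le_refl 0) rfl (by
      change k.predAbove 0 = 0
      simp)).trans (edgeElt_refl b y 0)
  rw [e, map_one]
  rfl

/-- The twisted coboundary of a normalized cochain is normalized. -/
theorem twistedD_degenerate {n : ℕ} (c : S _⦋n⦌ → A) (hc : ∀ x ∈ S.degenerate n, c x = 0)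
    (x : S _⦋n + 1⦌) (hx : x ∈ S.degenerate (n + 1)) : twistedD ρ b c x = 0 := by
  rw [SSet.degenerate_eq_iUnion_range_σ] at hx
  obtain ⟨_, ⟨k, rfl⟩, y, rfl⟩ := hx
  unfold twistedD
  -- Faces `k` and `k + 1` of `s_k y` both give back `y`, with opposite signs. For any other `j` the
  -- operator `δ_j` hits both `k` and `k + 1`, which `σ_k` identifies, so that face is degenerate.
  rw [Fintype.sum_eq_add k.castSucc k.succ k.castSucc_lt_succ.ne fun j hj => ?_]
  · rw [twistedFace_σ, twistedFace_σ, SimplexCategory.δ_comp_σ_self, SimplexCategory.δ_comp_σ_succ,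
      Fin.val_succ, Fin.val_castSucc, pow_succ, mul_neg_one, neg_smul, add_neg_cancel]
  · rw [twistedFace_σ]
    unfold transport
    rw [hc _ (map_mem_degenerate _ ?_ y), map_zero, smul_zero]
    intro hinj
    obtain ⟨p, hp⟩ := Fin.exists_succAbove_eq hj.1.symm
    obtain ⟨q, hq⟩ := Fin.exists_succAbove_eq hj.2.symm
    have hpq : p = q := hinj (show k.predAbove (j.succAbove p) = k.predAbove (j.succAbove q) by
      rw [hp, hq]; simp)
    rw [hpq, hq] at hp
    exact k.castSucc_lt_succ.ne hp.symm

/-! ### Cochains on the cylinder. -/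

/-- The cochain of the cylinder that extends a given cochain on the end `1` by zero. -/
def extendEnd {n : ℕ} (c : S _⦋n⦌ → A) (z : (S ⊗ Δ[1] : SSet.{u}) _⦋n⦌) : A :=
  open Classical in
  if ∀ k : Fin (n + 1), (show (Δ[1] : SSet.{u}) _⦋n⦌ from z.2) k = 1 then c z.1 else 0

theorem extendEnd_ι₁ {n : ℕ} (c : S _⦋n⦌ → A) (x : S _⦋n⦌) :
    extendEnd c (SSet.ι₁.app _ x) = c x := if_pos fun _ => rfl

theorem extendEnd_ι₀ {n : ℕ} (c : S _⦋n⦌ → A) (x : S _⦋n⦌) :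
    extendEnd c (SSet.ι₀.app _ x) = 0 :=
  if_neg fun h => absurd (show (0 : Fin 2) = 1 from h 0) (by decide)

theorem extendEnd_degenerate {n : ℕ} (c : S _⦋n⦌ → A) (hc : ∀ x ∈ S.degenerate n, c x = 0)
    (z : (S ⊗ Δ[1] : SSet.{u}) _⦋n⦌) (hz : z ∈ (S ⊗ Δ[1] : SSet.{u}).degenerate n) :
    extendEnd c z = 0 := by
  unfold extendEnd
  split_ifs
  · exact hc _ (SSet.degenerate_app_apply hz (SemiCartesianMonoidalCategory.fst S Δ[1]))
  · rfl

/-- The prism operator on cochains of a cylinder. -/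
def prismOp {n : ℕ} (c : (S ⊗ Δ[1] : SSet.{u}) _⦋n + 1⦌ → A) (x : S _⦋n⦌) : A :=
  ∑ i : Fin (n + 1), (-1 : ℤ) ^ (i : ℕ) • c ((prism S).h i x)

theorem prism_face_lower {n : ℕ} (i : Fin (n + 1)) (j : Fin (n + 2)) (h : j ≤ i.castSucc)
    (x : S _⦋n + 1⦌) :
    (S ⊗ Δ[1]).δ j.castSucc ((prism S).h i.succ x) = (prism S).h i (S.δ j x) :=
  ConcreteCategory.congr_hom ((prism S).h_succ_comp_δ_castSucc_of_lt j i h) x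

theorem prism_face_middle {n : ℕ} (i : Fin (n + 1)) (x : S _⦋n + 1⦌) :
    (S ⊗ Δ[1]).δ i.castSucc.succ ((prism S).h i.succ x) =
      (S ⊗ Δ[1]).δ i.castSucc.succ ((prism S).h i.castSucc x) :=
  ConcreteCategory.congr_hom ((prism S).h_succ_comp_δ_castSucc_succ i) x

theorem prism_face_upper {n : ℕ} (i : Fin (n + 1)) (j : Fin (n + 2)) (h : i.castSucc < j)
    (x : S _⦋n + 1⦌) :
    (S ⊗ Δ[1]).δ j.succ ((prism S).h i.castSucc x) = (prism S).h i (S.δ j x) :=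
  ConcreteCategory.congr_hom ((prism S).h_castSucc_comp_δ_succ_of_lt j i h) x

theorem prism_face_zero {n : ℕ} (x : S _⦋n⦌) :
    (S ⊗ Δ[1]).δ 0 ((prism S).h 0 x) = SSet.ι₁.app _ x :=
  ConcreteCategory.congr_hom ((prism S).h_zero_comp_δ_zero n) x

theorem prism_face_last {n : ℕ} (x : S _⦋n⦌) :
    (S ⊗ Δ[1]).δ (Fin.last (n + 1)) ((prism S).h (Fin.last n) x) = SSet.ι₀.app _ x :=
  ConcreteCategory.congr_hom ((prism S).h_last_comp_δ_last n) x

/-- The homotopy identities for degeneracies make every prism on a degenerate simplex degenerate: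
`h_i s_j` is `s_{j+1} h_i` for `i ≤ j` and `s_j h_{i-1}` for `i > j`. -/
theorem prismOp_degenerate {n : ℕ} (c : (S ⊗ Δ[1] : SSet.{u}) _⦋n + 1⦌ → A)
    (hc : ∀ z ∈ (S ⊗ Δ[1] : SSet.{u}).degenerate (n + 1), c z = 0)
    (x : S _⦋n⦌) (hx : x ∈ S.degenerate n) : prismOp c x = 0 := by
  refine Finset.sum_eq_zero fun i _ => ?_
  rw [hc, smul_zero]
  cases n with
  | zero => simp at hx
  | succ n =>
    rw [SSet.degenerate_eq_iUnion_range_σ] at hx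
    obtain ⟨_, ⟨j, rfl⟩, y, rfl⟩ := hx
    by_cases hij : i ≤ j.castSucc
    · obtain ⟨i, rfl⟩ := Fin.exists_castSucc_eq.mpr
        (Fin.ne_of_lt (lt_of_le_of_lt hij (Fin.castSucc_lt_last j)))
      have := ConcreteCategory.congr_hom ((prism S).h_comp_σ_succ_of_lt j i (by simpa using hij)) y
      change (S ⊗ Δ[1]).σ _ _ = (prism S).h i.castSucc (S.σ j y) at this
      rw [← this]
      exact SSet.σ_mem_degenerate _ _ _
    · obtain ⟨i, rfl⟩ := Fin.exists_succ_eq.mpr (Fin.ne_zero_of_lt (not_le.mp hij))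
      have := ConcreteCategory.congr_hom ((prism S).h_comp_σ_castSucc_of_le j i
        (by simpa [Fin.castSucc_lt_succ_iff] using hij)) y
      change (S ⊗ Δ[1]).σ _ _ = (prism S).h i.succ (S.σ j y) at this
      rw [← this]
      exact SSet.σ_mem_degenerate _ _ _

theorem edgeElt_prism {n : ℕ} (i : Fin (n + 1)) (x : S _⦋n⦌) {k l : Fin (n + 2)} (h : k ≤ l)
    {k' l' : Fin (n + 1)} (h' : k' ≤ l') (hk : i.predAbove k = k') (hl : i.predAbove l = l') :
    edgeElt (SemiCartesianMonoidalCategory.fst S Δ[1] ≫ b) ((prism S).h i x) h =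
      edgeElt b x h' := by
  have e : edgeElt (SemiCartesianMonoidalCategory.fst S Δ[1] ≫ b) ((prism S).h i x) h =
      edgeElt b (S.map (SimplexCategory.σ i).op x) h :=
    congrArg (fun y => edgeElt b y h) (prism_fst i x)
  rw [e, edgeElt_map]
  exact edgeElt_congr _ _ _ _ hk hl

/-- The first edge of the zeroth prism projects to a degenerate edge of `x`, so no twist appears at
this end. -/
theorem twistedFace_prism_zero {n : ℕ} (c : (S ⊗ Δ[1] : SSet.{u}) _⦋n⦌ → A) (x : S _⦋n⦌) :
    twistedFace ρ (SemiCartesianMonoidalCategory.fst S Δ[1] ≫ b) c 0 ((prism S).h 0 x) =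
      c (SSet.ι₁.app _ x) := by
  rw [twistedFace_eq _ _ _ _ _ rfl (prism_face_zero x).symm,
    edgeElt_prism b 0 x _ (le_refl 0) rfl (by simp), edgeElt_refl, inv_one, map_one]
  rfl

theorem twistedFace_prism_last {n : ℕ} (c : (S ⊗ Δ[1] : SSet.{u}) _⦋n⦌ → A) (x : S _⦋n⦌) :
    twistedFace ρ (SemiCartesianMonoidalCategory.fst S Δ[1] ≫ b) c (Fin.last (n + 1))
      ((prism S).h (Fin.last n) x) = c (SSet.ι₀.app _ x) := by
  rw [← Fin.succ_last, twistedFace_succ]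
  exact congrArg c (prism_face_last x)

/-- In degree `0` there is a single prism and no prism operator in lower degree: a cocycle has equal
restrictions to the two ends. -/
theorem sum_twistedD_prism_zero (c : (S ⊗ Δ[1] : SSet.{u}) _⦋0⦌ → A) (x : S _⦋0⦌) :
    twistedD ρ (SemiCartesianMonoidalCategory.fst S Δ[1] ≫ b) c ((prism S).h 0 x) =
      c (SSet.ι₁.app _ x) - c (SSet.ι₀.app _ x) := by
  have h0 := twistedFace_prism_zero ρ b c x
  have h1 := twistedFace_prism_last ρ b c x
  unfold twistedD
  rw [Fin.sum_univ_two, h0]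
  change _ + (-1 : ℤ) ^ 1 • twistedFace ρ (SemiCartesianMonoidalCategory.fst S Δ[1] ≫ b) c
    (Fin.last 1) ((prism S).h (Fin.last 0) x) = _
  rw [h1]
  simp [sub_eq_add_neg]

/-- The prism operator is a chain homotopy between the restrictions to the two ends. -/
theorem sum_twistedD_prism {n : ℕ} (c : (S ⊗ Δ[1] : SSet.{u}) _⦋n + 1⦌ → A) (x : S _⦋n + 1⦌) :
    ∑ i : Fin (n + 2), (-1 : ℤ) ^ (i : ℕ) •
      twistedD ρ (SemiCartesianMonoidalCategory.fst S Δ[1] ≫ b) c ((prism S).h i x) =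
    c (SSet.ι₁.app _ x) - c (SSet.ι₀.app _ x) - twistedD ρ b (prismOp c) x := by
  rw [← twistedFace_prism_zero ρ b c, ← twistedFace_prism_last ρ b c]
  refine (sum_prism (fun i j => twistedFace ρ
    (SemiCartesianMonoidalCategory.fst S Δ[1] ≫ b) c j ((prism S).h i x))
    (fun i j => twistedFace ρ b (fun y => c ((prism S).h i y)) j x) ?_ ?_ ?_).trans ?_
  · intro i j hij
    dsimp only
    rw [twistedFace_eq _ _ _ j.castSucc _ rfl (prism_face_lower i j hij x).symm]
    -- Only `j = 0` carries a twist. As the prism index `i + 1` is positive, the first edge of the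
    -- prism lies over the first edge of `x`, so both sides are twisted by the same element.
    have e := edgeElt_prism b i.succ x (Fin.zero_le (j.castSucc.succAbove 0))
      (Fin.zero_le (j.succAbove 0)) (by simp) (by
        rcases Fin.eq_zero_or_eq_succ j with rfl | ⟨j, rfl⟩
        · rfl
        · rw [← Fin.succ_castSucc, Fin.succ_succAbove_zero, Fin.succ_succAbove_zero]
          simp)
    rw [e]
    rfl
  · intro i
    dsimp only
    rw [twistedFace_succ, twistedFace_succ]
    exact congrArg c (prism_face_middle i x)
  · intro i j hij
    obtain ⟨j, rfl⟩ := Fin.exists_succ_eq.mpr (Fin.ne_zero_of_lt hij)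
    dsimp only
    rw [twistedFace_succ, twistedFace_succ]
    exact congrArg c (prism_face_upper i _ hij x)
  · congr 1
    unfold twistedD twistedFace prismOp
    simp only [map_sum, map_zsmul, Finset.smul_sum]
    rw [Finset.sum_comm]
    refine Finset.sum_congr rfl fun j _ => Finset.sum_congr rfl fun i _ => ?_
    rw [smul_comm]

end Twisted

/-! ### Liftings to the generalized Eilenberg–MacLane complex and twisted cocycles -/

section Liftings

variable {G : Type u} [Group G] {P : (OrbitCat G)ᵒᵖ ⥤ GrpCat.{u}}
  {A : (OrbitCat G)ᵒᵖ ⥤ AddCommGrpCat.{u}} (φ : OAction P A) {Y : (OrbitCat G)ᵒᵖ ⥤ SSet.{u}}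
  (θ : Y ⟶ WBar P)

/-- The component of a map to `W̄P` at an orbit, with the bar construction unfolded. -/
def wBarApp (H : (OrbitCat G)ᵒᵖ) : Y.obj H ⟶ nerve (SingleObj (P.obj H)) := θ.app H

variable (A Y) in
/-- The group of normalized cochains on an `O_G`-simplicial set with coefficients in an abelian
`O_G`-group. -/
def OCochains (n : ℕ) : AddSubgroup (∀ H : (OrbitCat G)ᵒᵖ, (Y.obj H) _⦋n⦌ → A.obj H) where
  carrier := {u | (∀ H, ∀ x ∈ (Y.obj H).degenerate n, u H x = 0) ∧
    ∀ (K H : (OrbitCat G)ᵒᵖ) (f : K ⟶ H) (x : (Y.obj K) _⦋n⦌),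
      u H ((Y.map f).app _ x) = A.map f (u K x)}
  zero_mem' := ⟨fun _ _ _ => rfl, fun _ _ _ _ => (map_zero _).symm⟩
  add_mem' {u w} hu hw := ⟨fun H x hx => by
      rw [Pi.add_apply, Pi.add_apply, hu.1 H x hx, hw.1 H x hx, add_zero],
    fun K H f x => by simp only [Pi.add_apply, hu.2 K H f x, hw.2 K H f x, map_add]⟩
  neg_mem' {u} hu := ⟨fun H x hx => by
      rw [Pi.neg_apply, Pi.neg_apply, hu.1 H x hx, neg_zero],
    fun K H f x => by simp only [Pi.neg_apply, hu.2 K H f x, map_neg]⟩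

/-- The twisted coboundary of cochains on an `O_G`-simplicial set over `W̄P`. -/
def oCoboundary (n : ℕ) : (∀ H : (OrbitCat G)ᵒᵖ, (Y.obj H) _⦋n⦌ → A.obj H) →+
    (∀ H : (OrbitCat G)ᵒᵖ, (Y.obj H) _⦋n + 1⦌ → A.obj H) where
  toFun u H := twistedD (φ.act H) (wBarApp θ H) (u H)
  map_zero' := by
    funext H x
    exact Finset.sum_eq_zero fun j _ =>
      (congrArg _ (map_zero (φ.act H _))).trans (smul_zero _)
  map_add' u w := by
    funext H x
    refine Eq.trans ?_ Finset.sum_add_distrib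
    exact Finset.sum_congr rfl fun j _ => (congrArg _ (map_add (φ.act H _) _ _)).trans (smul_add _ _ _)

/-- The twisted cocycles. -/
def OCocycles (n : ℕ) : AddSubgroup (∀ H : (OrbitCat G)ᵒᵖ, (Y.obj H) _⦋n⦌ → A.obj H) :=
  OCochains A Y n ⊓ (oCoboundary φ θ n).ker

/-- The twisted coboundaries: zero for `n = 0`, and `d(C^k)` for `n = k + 1`. -/
def OCoboundaries (n : ℕ) : AddSubgroup (∀ H : (OrbitCat G)ᵒᵖ, (Y.obj H) _⦋n⦌ → A.obj H) :=
  Nat.casesOn (motive := fun n =>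
      AddSubgroup (∀ H : (OrbitCat G)ᵒᵖ, (Y.obj H) _⦋n⦌ → A.obj H)) n ⊥
    (fun k => (OCochains A Y k).map (oCoboundary φ θ k))

/-- The simplex `(c, b)` of `L_φ(A, n)`, as a pair. -/
def lPair {n : ℕ} {H : (OrbitCat G)ᵒᵖ} {q : ℕ} (z : ((LComplex φ n).obj H) _⦋q⦌) :
    simpCocycles (A.obj H) n q × ComposableArrows (SingleObj (P.obj H)) q := z

/-- The fundamental cochain of a map to `L_φ(A, n)`. -/
def pullFundamental {n : ℕ} (F : Y ⟶ LComplex φ n) (H : (OrbitCat G)ᵒᵖ) (x : (Y.obj H) _⦋n⦌) :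
    A.obj H :=
  fundamental φ n H ((F.app H).app _ x)

theorem edgeElt_orbit {K H : (OrbitCat G)ᵒᵖ} (f : K ⟶ H) {q : ℕ} (x : (Y.obj K) _⦋q⦌)
    {i j : Fin (q + 1)} (h : i ≤ j) :
    edgeElt (wBarApp θ H) ((Y.map f).app _ x) h = P.map f (edgeElt (wBarApp θ K) x h) := by
  have e := congrArg (fun η => η.app (op ⦋q⦌) x) (θ.naturality f)
  exact congrArg (fun c : ComposableArrows (SingleObj (P.obj H)) q => barEdge c h) e

theorem transport_orbit {n : ℕ} {u : ∀ H : (OrbitCat G)ᵒᵖ, (Y.obj H) _⦋n⦌ → A.obj H}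
    (hu : u ∈ OCochains A Y n) {K H : (OrbitCat G)ᵒᵖ} (f : K ⟶ H) {q : ℕ} (x : (Y.obj K) _⦋q⦌)
    (α : ⦋n⦌ ⟶ ⦋q⦌) :
    transport (φ.act H) (wBarApp θ H) (u H) ((Y.map f).app _ x) α =
      A.map f (transport (φ.act K) (wBarApp θ K) (u K) x α) := by
  unfold transport
  rw [edgeElt_orbit, ← NatTrans.naturality_apply (Y.map f) α.op x, hu.2 K H f, ← map_inv,
    φ.natural f]

theorem oCoboundary_mem {n : ℕ} {u : ∀ H : (OrbitCat G)ᵒᵖ, (Y.obj H) _⦋n⦌ → A.obj H}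
    (hu : u ∈ OCochains A Y n) : oCoboundary φ θ n u ∈ OCocycles φ θ (n + 1) := by
  refine ⟨⟨fun H x hx => twistedD_degenerate _ _ (u H) (hu.1 H) x hx, fun K H f x => ?_⟩, ?_⟩
  · change twistedD _ _ _ _ = A.map f (twistedD _ _ _ _)
    refine Eq.trans (Finset.sum_congr rfl fun j _ => ?_) (map_sum (A.map f).hom _ _).symm
    exact (congrArg _ (transport_orbit φ θ hu f x (SimplexCategory.δ j))).trans
      (map_zsmul (A.map f).hom _ _).symm
  · funext H x
    exact twistedD_twistedD _ _ (u H) x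

variable {θ}

theorem lPair_snd {n : ℕ} {F : Y ⟶ LComplex φ n} (hF : F ≫ LProj φ n = θ) (H : (OrbitCat G)ᵒᵖ)
    {q : ℕ} (x : (Y.obj H) _⦋q⦌) :
    (lPair φ ((F.app H).app _ x)).2 = (wBarApp θ H).app (op ⦋q⦌) x := by
  subst hF; rfl

/-- The value of the cocycle component of a lifting on an operator is the transport of the
fundamental cochain. -/
theorem pullFundamental_map {n : ℕ} {F : Y ⟶ LComplex φ n} (hF : F ≫ LProj φ n = θ)
    (H : (OrbitCat G)ᵒᵖ) {q : ℕ} (x : (Y.obj H) _⦋q⦌) (α : ⦋n⦌ ⟶ ⦋q⦌) :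
    pullFundamental φ F H ((Y.obj H).map α.op x) =
      φ.act H (edgeElt (wBarApp θ H) x (Fin.zero_le (α 0)))
        ((lPair φ ((F.app H).app _ x)).1.1 (SSet.stdSimplex.objEquiv.symm α)) := by
  have h := NatTrans.naturality_apply (F.app H) α.op x
  subst hF
  refine (congrArg (fundamental φ n H) h).trans ?_
  refine congrArg (fun β => φ.act H (edgeElt (wBarApp (F ≫ LProj φ n) H) x (Fin.zero_le (α 0)))
    ((lPair φ ((F.app H).app _ x)).1.1 (SSet.stdSimplex.objEquiv.symm β))) (Category.id_comp α)

/-- The cocycle component of a lifting is the transport of its fundamental cochain. -/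
theorem transport_pullFundamental {n : ℕ} {F : Y ⟶ LComplex φ n} (hF : F ≫ LProj φ n = θ)
    (H : (OrbitCat G)ᵒᵖ) {q : ℕ} (x : (Y.obj H) _⦋q⦌) (α : ⦋n⦌ ⟶ ⦋q⦌) :
    transport (φ.act H) (wBarApp θ H) (pullFundamental φ F H) x α =
      (lPair φ ((F.app H).app _ x)).1.1 (SSet.stdSimplex.objEquiv.symm α) := by
  unfold transport
  rw [pullFundamental_map φ hF, act_inv_act]

/-- The cocycle condition comes from the ordinary one for the component `c` of `F(x)` on the top
simplex of `Δ[n+1]`: the value of `c` on the `j`-th face of that simplex is the `j`-th twisted face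
of the fundamental cochain. -/
theorem pullFundamental_mem {n : ℕ} {F : Y ⟶ LComplex φ n} (hF : F ≫ LProj φ n = θ) :
    pullFundamental φ F ∈ OCocycles φ θ n := by
  refine ⟨⟨?_, ?_⟩, ?_⟩
  · rintro H _ ⟨m, hm, α, x, rfl⟩
    rw [pullFundamental_map φ hF, (lPair φ ((F.app H).app _ x)).1.2.1, map_zero]
    refine ⟨m, hm, α, SSet.stdSimplex.objEquiv.symm (𝟙 _), ?_⟩
    exact congrArg SSet.stdSimplex.objEquiv.symm (Category.comp_id α)
  · intro K H f x
    have h := congrArg (fun k => k.app (op ⦋n⦌) x) (F.naturality f)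
    exact (congrArg (fundamental φ n H) h).trans rfl
  · funext H x
    have h := (lPair φ ((F.app H).app _ x)).1.2.2 (SSet.stdSimplex.objEquiv.symm (𝟙 _))
    refine (Finset.sum_congr rfl fun j _ => congrArg _ ?_).trans h
    refine (transport_pullFundamental φ hF H x (SimplexCategory.δ j)).trans ?_
    exact congrArg (fun β => (lPair φ ((F.app H).app _ x)).1.1 (SSet.stdSimplex.objEquiv.symm β))
      (Category.comp_id (SimplexCategory.δ j)).symm

theorem lifting_ext {n : ℕ} {F F' : Y ⟶ LComplex φ n} (hF : F ≫ LProj φ n = θ)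
    (hF' : F' ≫ LProj φ n = θ) (h : pullFundamental φ F = pullFundamental φ F') : F = F' := by
  apply NatTrans.ext; funext H
  apply NatTrans.ext; funext k
  apply ConcreteCategory.hom_ext; intro x
  refine Prod.ext (Subtype.ext (funext fun α => ?_))
    ((lPair_snd φ hF H (q := k.unop.len) x).trans (lPair_snd φ hF' H (q := k.unop.len) x).symm)
  have e := transport_pullFundamental φ hF H (q := k.unop.len) x (SSet.stdSimplex.objEquiv α)
  have e' := transport_pullFundamental φ hF' H (q := k.unop.len) x (SSet.stdSimplex.objEquiv α)
  rw [h] at e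
  rw [Equiv.symm_apply_apply] at e e'
  exact e.symm.trans e'

/-- The simplex of `L_φ(A, n)` assigned to a simplex by the lifting of a twisted cocycle. -/
def liftSimplex {n : ℕ} (u : OCocycles φ θ n) (H : (OrbitCat G)ᵒᵖ) {q : ℕ}
    (x : (Y.obj H) _⦋q⦌) : simpCocycles (A.obj H) n q :=
  ⟨fun α => transport (φ.act H) (wBarApp θ H) (u.1 H) x (SSet.stdSimplex.objEquiv α), by
    refine ⟨?_, fun α => ?_⟩
    · rintro _ ⟨m, hm, β, α, rfl⟩
      unfold transport
      refine (congrArg _ (u.2.1.1 H _ ⟨m, hm, β, (Y.obj H).map (SSet.stdSimplex.objEquiv α).op x,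
        ?_⟩)).trans (map_zero _)
      exact (Functor.map_comp_apply (Y.obj H) (SSet.stdSimplex.objEquiv α).op β.op x).symm
    · have h : twistedD (φ.act H) (wBarApp θ H) (u.1 H)
          ((Y.obj H).map (SSet.stdSimplex.objEquiv α).op x) = 0 :=
        congrFun (congrFun u.2.2 H) ((Y.obj H).map (SSet.stdSimplex.objEquiv α).op x)
      -- The twisted cocycle condition at `α^* x`, moved back to the initial vertex of `x`, loses
      -- its twist and becomes the ordinary cocycle condition at `α`.
      have h' := congrArg (φ.act H (edgeElt (wBarApp θ H) x
        (Fin.zero_le ((SSet.stdSimplex.objEquiv α) 0)))⁻¹) h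
      refine Eq.trans ?_ (h'.trans (map_zero _))
      unfold twistedD
      refine Eq.trans ?_ (map_sum (φ.act H _) _ _).symm
      refine Finset.sum_congr rfl fun j _ => ?_
      refine Eq.trans ?_ (map_zsmul (φ.act H _) _ _).symm
      exact congrArg _ (transport_comp (φ.act H) (wBarApp θ H) (u.1 H) x
        (SSet.stdSimplex.objEquiv α) (SimplexCategory.δ j))⟩

/-- The lifting of `θ` belonging to a twisted cocycle. -/
def liftOfCocycle {n : ℕ} (u : OCocycles φ θ n) : Y ⟶ LComplex φ n where
  app H :=
    { app k := ↾fun x => (liftSimplex φ u H (q := k.unop.len) x, (wBarApp θ H).app k x)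
      naturality k l α := by
        apply ConcreteCategory.hom_ext; intro x
        have hθ := NatTrans.naturality_apply (wBarApp θ H) α x
        refine Prod.ext (Subtype.ext (funext fun β => ?_)) hθ
        -- The group element in the operators of `L_φ(A, n)` cancels the transport from the initial
        -- vertex of `α^* x` to that of `x`.
        exact (act_transport_comp (φ.act H) (wBarApp θ H) (u.1 H) (q := k.unop.len)
          (m := l.unop.len) x α.unop (SSet.stdSimplex.objEquiv β)).symm }
  naturality K H f := by
    apply NatTrans.ext; funext k
    apply ConcreteCategory.hom_ext; intro x
    have hθ := congrArg (fun η => η.app k x) (θ.naturality f)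
    refine Prod.ext (Subtype.ext (funext fun β => ?_)) hθ
    refine Eq.trans ?_ (congrArg (fun γ => A.map f (transport (φ.act K) (wBarApp θ K) (u.1 K)
      (q := k.unop.len) x γ)) (Category.comp_id (SSet.stdSimplex.objEquiv β)).symm)
    exact transport_orbit φ θ u.2.1 f x _

theorem liftOfCocycle_proj {n : ℕ} (u : OCocycles φ θ n) :
    liftOfCocycle φ u ≫ LProj φ n = θ := rfl

theorem pullFundamental_liftOfCocycle {n : ℕ} (u : OCocycles φ θ n) :
    pullFundamental φ (liftOfCocycle φ u) = u.1 := by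
  funext H x
  exact transport_id (φ.act H) (wBarApp θ H) (u.1 H) x

end Liftings

/-! ### Vertical homotopies and coboundaries -/

section Homotopies

variable {G : Type u} [Group G] {X : Action SSet.{u} G} {P : (OrbitCat G)ᵒᵖ ⥤ GrpCat.{u}}
  {A : (OrbitCat G)ᵒᵖ ⥤ AddCommGrpCat.{u}} (φ : OAction P A) {θ : Phi X ⟶ WBar P}

/-- The end `0` of the cylinder `ΦX × Δ[1]`. -/
def cylι₀ (X : Action SSet.{u} G) : Phi X ⟶ PhiCyl X where
  app H := SSet.ι₀

/-- The end `1` of the cylinder `ΦX × Δ[1]`. -/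
def cylι₁ (X : Action SSet.{u} G) : Phi X ⟶ PhiCyl X where
  app H := SSet.ι₁

/-- Two maps `ΦX → L_φ(A, n)` are homotopic over `θ`. -/
def HomotopicOver (θ : Phi X ⟶ WBar P) {n : ℕ} (F F' : Phi X ⟶ LComplex φ n) : Prop :=
  ∃ K : PhiCyl X ⟶ LComplex φ n,
    (∀ H, SSet.ι₀ ≫ K.app H = F.app H) ∧ (∀ H, SSet.ι₁ ≫ K.app H = F'.app H) ∧
    K ≫ LProj φ n = cylFst X ≫ θ

theorem prismOp_mem {n : ℕ} {u : ∀ H : (OrbitCat G)ᵒᵖ, ((PhiCyl X).obj H) _⦋n + 1⦌ → A.obj H}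
    (hu : u ∈ OCochains A (PhiCyl X) (n + 1)) :
    (fun H => prismOp (u H)) ∈ OCochains A (Phi X) n := by
  refine ⟨fun H x hx => prismOp_degenerate (u H) (hu.1 H) x hx, fun K H f x => ?_⟩
  refine Eq.trans (Finset.sum_congr rfl fun i _ => ?_) (map_sum (A.map f).hom _ _).symm
  refine Eq.trans ?_ (map_zsmul (A.map f).hom _ _).symm
  refine congrArg _ ?_
  rw [prism_naturality]
  exact hu.2 K H f _

theorem extendEnd_mem {n : ℕ} {w : ∀ H : (OrbitCat G)ᵒᵖ, ((Phi X).obj H) _⦋n⦌ → A.obj H}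
    (hw : w ∈ OCochains A (Phi X) n) :
    (fun H => extendEnd (w H)) ∈ OCochains A (PhiCyl X) n := by
  refine ⟨fun H z hz => extendEnd_degenerate (w H) (hw.1 H) z hz, fun K H f z => ?_⟩
  by_cases h : ∀ k : Fin (n + 1), (show (Δ[1] : SSet.{u}) _⦋n⦌ from z.2) k = 1
  · refine (if_pos h).trans ((hw.2 K H f z.1).trans (congrArg (A.map f) (if_pos h).symm))
  · refine (if_neg h).trans ((map_zero (A.map f).hom).symm.trans
      (congrArg (A.map f) (if_neg h).symm))

/-- The homotopy is itself a lifting on the cylinder, so it has a twisted cocycle there; the prism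
operator applied to that cocycle bounds the difference. -/
theorem HomotopicOver.sub_mem {n : ℕ} {F F' : Phi X ⟶ LComplex φ n}
    (h : HomotopicOver φ θ F F') :
    pullFundamental φ F' - pullFundamental φ F ∈ OCoboundaries φ θ n := by
  obtain ⟨K, h₀, h₁, hK⟩ := h
  have hu := pullFundamental_mem φ hK
  have e₀ : ∀ H x, pullFundamental φ F H x = pullFundamental φ K H (SSet.ι₀.app _ x) :=
    fun H x => congrArg (fun k : (Phi X).obj H ⟶ (LComplex φ n).obj H => fundamental φ n H (k.app _ x)) (h₀ H).symm
  have e₁ : ∀ H x, pullFundamental φ F' H x = pullFundamental φ K H (SSet.ι₁.app _ x) :=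
    fun H x => congrArg (fun k : (Phi X).obj H ⟶ (LComplex φ n).obj H => fundamental φ n H (k.app _ x)) (h₁ H).symm
  have hd : ∀ H z, twistedD (φ.act H)
      (SemiCartesianMonoidalCategory.fst ((Phi X).obj H) Δ[1] ≫ wBarApp θ H)
      (pullFundamental φ K H) z = 0 := fun H z => congrFun (congrFun hu.2 H) z
  cases n with
  | zero =>
    refine (AddSubgroup.mem_bot).mpr ?_
    funext H x
    have := sum_twistedD_prism_zero (φ.act H) (wBarApp θ H) (pullFundamental φ K H) x
    rw [hd] at this
    rw [Pi.sub_apply, Pi.sub_apply, e₀, e₁]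
    exact this.symm
  | succ n =>
    refine ⟨fun H => prismOp (pullFundamental φ K H), prismOp_mem hu.1, ?_⟩
    funext H x
    have := sum_twistedD_prism (φ.act H) (wBarApp θ H) (pullFundamental φ K H) x
    rw [Finset.sum_eq_zero fun i _ => by rw [hd, smul_zero]] at this
    rw [Pi.sub_apply, Pi.sub_apply, e₀, e₁]
    exact (sub_eq_zero.mp this.symm).symm

theorem HomotopicOver.of_sub_mem {n : ℕ} {F F' : Phi X ⟶ LComplex φ n}
    (hF : F ≫ LProj φ n = θ) (hF' : F' ≫ LProj φ n = θ)
    (h : pullFundamental φ F' - pullFundamental φ F ∈ OCoboundaries φ θ n) :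
    HomotopicOver φ θ F F' := by
  cases n with
  | zero =>
    -- There are no nonzero coboundaries in degree `0`, so the liftings coincide and the constant
    -- homotopy serves.
    have e : F' = F := lifting_ext φ hF' hF (sub_eq_zero.mp ((AddSubgroup.mem_bot).mp h))
    subst e
    exact ⟨cylFst X ≫ F', fun H => rfl, fun H => rfl, by rw [Category.assoc, hF]⟩
  | succ n =>
    obtain ⟨w, hw, e⟩ := h
    have hFu := pullFundamental_mem φ hF
    -- The cochain of the homotopy: the pullback of the cocycle of `F`, plus the coboundary of `w`
    -- extended by zero from the end `1`. The second summand vanishes at the end `0` and is `dw` at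
    -- the end `1`.
    let u : ∀ H : (OrbitCat G)ᵒᵖ, ((PhiCyl X).obj H) _⦋n + 1⦌ → A.obj H := fun H z =>
      pullFundamental φ (cylFst X ≫ F) H z +
        oCoboundary φ (cylFst X ≫ θ) n (fun H => extendEnd (w H)) H z
    have hu : u ∈ OCocycles φ (cylFst X ≫ θ) (n + 1) :=
      add_mem (pullFundamental_mem φ (by rw [Category.assoc, hF]))
        (oCoboundary_mem φ _ (extendEnd_mem hw))
    have hr : ∀ {ι : Phi X ⟶ PhiCyl X} (hι : ι ≫ cylFst X = 𝟙 _) (F'' : Phi X ⟶ LComplex φ (n + 1))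
        (hF'' : F'' ≫ LProj φ (n + 1) = θ)
        (hr : ∀ H x, u H ((ι.app H).app _ x) = pullFundamental φ F'' H x),
        ι ≫ liftOfCocycle φ ⟨u, hu⟩ = F'' := by
      intro ι hι F'' hF'' hr
      have hp : (ι ≫ liftOfCocycle φ ⟨u, hu⟩) ≫ LProj φ (n + 1) = θ := by
        rw [Category.assoc, liftOfCocycle_proj, ← Category.assoc, hι, Category.id_comp]
      refine lifting_ext φ hp hF'' ?_
      funext H x
      refine Eq.trans ?_ (hr H x)
      exact congrFun (congrFun (pullFundamental_liftOfCocycle φ ⟨u, hu⟩) H) ((ι.app H).app _ x)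
    refine ⟨liftOfCocycle φ ⟨u, hu⟩, fun H => ?_, fun H => ?_, liftOfCocycle_proj φ _⟩
    · refine congrArg (fun k => k.app H) (hr (ι := cylι₀ X) rfl F hF fun H x => ?_)
      refine (congrArg (pullFundamental φ F H x + ·) ?_).trans (add_zero _)
      refine (twistedD_comp (φ.act H) (SemiCartesianMonoidalCategory.fst ((Phi X).obj H) Δ[1] ≫
        wBarApp θ H) SSet.ι₀ (extendEnd (w H)) x).symm.trans ?_
      simp only [extendEnd_ι₀]
      exact congrFun (congrFun (map_zero (oCoboundary φ θ n)) H) x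
    · refine congrArg (fun k => k.app H) (hr (ι := cylι₁ X) rfl F' hF' fun H x => ?_)
      refine (congrArg (pullFundamental φ F H x + ·) (Eq.trans ?_ (congrFun (congrFun e H) x))).trans
        (add_sub_cancel _ _)
      refine (twistedD_comp (φ.act H) (SemiCartesianMonoidalCategory.fst ((Phi X).obj H) Δ[1] ≫
        wBarApp θ H) SSet.ι₁ (extendEnd (w H)) x).symm.trans ?_
      simp only [extendEnd_ι₁]
      rfl

end Homotopies

/-! ### Comparison of equivariant cochains with twisted cochains -/

section Comparison

variable {G : Type u} [Group G] {X : Action SSet.{u} G}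

/-- The morphism of `ΠX` over an identity given by a class of paths. -/
def pathHom {A : OrbitCat G} {x y : OrbitMap A.H (Realiz X)}
    (p : FundamentalGroupoid.mk x ⟶ FundamentalGroupoid.mk y) :
    (⟨A, x⟩ : PiObj X) ⟶ ⟨A, y⟩ := ⟨𝟙 A, p⟩

theorem pathHom_id {A : OrbitCat G} (x : OrbitMap A.H (Realiz X)) :
    pathHom (𝟙 (FundamentalGroupoid.mk x)) = 𝟙 (⟨A, x⟩ : PiObj X) := rfl

theorem pathHom_comp {A : OrbitCat G} {x y z : OrbitMap A.H (Realiz X)}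
    (p : FundamentalGroupoid.mk x ⟶ FundamentalGroupoid.mk y)
    (q : FundamentalGroupoid.mk y ⟶ FundamentalGroupoid.mk z) :
    pathHom p ≫ pathHom q = pathHom (p ≫ q) :=
  congrArg (fun r => (⟨𝟙 A, r⟩ : PiObj.Hom (⟨A, x⟩ : PiObj X) ⟨A, z⟩))
    (congrArg (fun r => p ≫ r) (PiObj.pull_id q))

/-- The isomorphism of `ΠX` over an identity given by a class of paths. -/
def pathIso {A : OrbitCat G} {x y : OrbitMap A.H (Realiz X)}
    (p : FundamentalGroupoid.mk x ⟶ FundamentalGroupoid.mk y) :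
    (⟨A, x⟩ : PiObj X) ≅ ⟨A, y⟩ where
  hom := pathHom p
  inv := pathHom (Groupoid.inv p)
  hom_inv_id := by rw [pathHom_comp, Groupoid.comp_inv, pathHom_id]
  inv_hom_id := by rw [pathHom_comp, Groupoid.inv_comp, pathHom_id]

theorem eqSimplex_value {n : ℕ} (σ : EqSimp X n) : eqSimplex σ.value = σ.map :=
  OrbitMap.ext_one (OrbitMap.ofFixed_one _ _)

theorem value_eqSimplex {n : ℕ} {A : OrbitCat G} (x : (fixedSub X A.H : SSet.{u}) _⦋n⦌) :
    (⟨A, eqSimplex x⟩ : EqSimp X n).value = x :=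
  Subtype.ext (OrbitMap.ofFixed_one x.1 x.2)

theorem value_pre {n : ℕ} {A : OrbitCat G} (τ : EqSimp X n) (g : A ⟶ τ.orb) :
    ((Phi X).map g.op).app (op ⦋n⦌) τ.value = (τ.pre g).value :=
  Subtype.ext (congrArg (fun s : OrbitMap τ.orb.H (X.V _⦋n⦌) => s (OrbitCat.img g))
    (eqSimplex_value τ))

variable {v : FixedVertex X} (M : LocalCoeff X) (ω : PathSystem v)

/-- The isomorphism of `ΠX` from the fixed vertex to the initial vertex of a simplex. -/
def xiIso {n : ℕ} (σ : EqSimp X n) : v.functor.obj σ.orb ≅ σ.initial :=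
  pathIso (ω.xi (vert σ.map 0))

theorem xi_eqToHom {A : OrbitCat G} {s t : OrbitMap A.H (X.V _⦋0⦌)} (h : s = t)
    (e : (⟨A, ptMap s⟩ : PiObj X) = ⟨A, ptMap t⟩) :
    pathHom (ω.xi s) ≫ eqToHom e = pathHom (ω.xi t) := by
  subst h
  exact Category.comp_id _

theorem xiHom_face_succ {n : ℕ} (σ : EqSimp X (n + 1)) (j : Fin (n + 1)) :
    xiHom v ω σ ≫ eqToHom (σ.initial_face_succ j) = xiHom v ω (σ.face j.succ) := by
  refine xi_eqToHom ω ?_ _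
  exact ((vert_face σ.map j.succ 0).trans (by rw [Fin.succ_succAbove_zero])).symm

/-- This is where `κ` arises: the loop was defined so that following it by the path to the second
vertex gives the path to the first vertex followed by the edge. -/
theorem xiHom_face_zero {n : ℕ} (σ : EqSimp X (n + 1)) :
    xiHom v ω σ ≫ σ.star = v.loopHom σ.orb (ω.loop σ.map 0 1) ≫ xiHom v ω (σ.face 0) := by
  have h : pathHom (ω.xi (vert σ.map 1)) ≫ eqToHom σ.initial_face_zero =
      xiHom v ω (σ.face 0) := xi_eqToHom ω (vert_face σ.map 0 0).symm _
  have h1 : pathHom (ω.loop σ.map 0 1) ≫ pathHom (ω.xi (vert σ.map 1)) =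
      pathHom (ω.xi (vert σ.map 0)) ≫ pathHom (edge σ.map 0 1) := by
    rw [pathHom_comp, pathHom_comp]
    refine congrArg pathHom ?_
    unfold PathSystem.loop
    simp
  rw [← h]
  exact (Category.assoc _ _ _).symm.trans ((congrArg (· ≫ eqToHom σ.initial_face_zero) h1.symm).trans
    (Category.assoc _ _ _))

/-- Equivariance of `ω` is what makes the transport natural in the orbit: restricting the path class
of `τ` along `g` gives the path class of `τ.pre g`. -/
theorem functor_map_xiHom {n : ℕ} {A : OrbitCat G} (τ : EqSimp X n) (g : A ⟶ τ.orb) :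
    v.functor.map g ≫ xiHom v ω τ = xiHom v ω (τ.pre g) ≫ τ.preHom g := by
  refine congrArg (fun p => (⟨g, p⟩ : PiObj.Hom (v.functor.obj A) τ.initial)) ?_
  refine (Category.id_comp (PiObj.pull g (ω.xi (vert τ.map 0)))).trans ?_
  exact (Category.comp_id (PiObj.pull g (ω.xi (vert τ.map 0)))).symm

theorem map_xiHom_injective {n : ℕ} (σ : EqSimp X n) :
    Function.Injective (M.map (xiHom v ω σ).op) := by
  have h : ∀ m, M.map (xiIso ω σ).inv.op (M.map (xiHom v ω σ).op m) = m := fun m => by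
    rw [← Functor.map_comp_apply, ← op_comp]
    exact (congrArg (fun k : σ.initial ⟶ σ.initial => M.map k.op m) (xiIso ω σ).inv_hom_id).trans
      (Functor.map_id_apply M _ m)
  exact Function.LeftInverse.injective h

theorem map_xiHom_inv {n : ℕ} (σ : EqSimp X n) (m : M.obj (op (v.functor.obj σ.orb))) :
    M.map (xiHom v ω σ).op (M.map (xiIso ω σ).inv.op m) = m := by
  rw [← Functor.map_comp_apply, ← op_comp]
  exact (congrArg (fun k : v.functor.obj σ.orb ⟶ v.functor.obj σ.orb => M.map k.op m)
    (xiIso ω σ).hom_inv_id).trans (Functor.map_id_apply M _ m)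

/-- Transport of cochains on equivariant simplices to the fixed vertex along the chosen paths. -/
def toFixedVertex (n : ℕ) : AllCochains M n →+
    (∀ H : (OrbitCat G)ᵒᵖ, ((Phi X).obj H) _⦋n⦌ → (v.M₀ M).obj H) where
  toFun f H x := M.map (xiHom v ω ⟨H.unop, eqSimplex x⟩).op (f ⟨H.unop, eqSimplex x⟩)
  map_zero' := by
    funext H x
    exact map_zero (M.map (xiHom v ω ⟨H.unop, eqSimplex x⟩).op).hom
  map_add' f g := by
    funext H x
    exact map_add (M.map (xiHom v ω ⟨H.unop, eqSimplex x⟩).op).hom _ _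

theorem toFixedVertex_value {n : ℕ} (f : AllCochains M n) (σ : EqSimp X n) :
    toFixedVertex M ω n f (op σ.orb) σ.value = M.map (xiHom v ω σ).op (f σ) := by
  have : ∀ s : OrbitMap σ.orb.H (X.V _⦋n⦌), s = σ.map →
      (show (v.M₀ M).obj (op σ.orb) from
        M.map (xiHom v ω ⟨σ.orb, s⟩).op (f ⟨σ.orb, s⟩)) = M.map (xiHom v ω σ).op (f σ) := by
    rintro s rfl
    rfl
  exact this _ (eqSimplex_value σ)

theorem toFixedVertex_bijective (n : ℕ) : Function.Bijective (toFixedVertex M ω n) := by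
  constructor
  · intro f g h
    funext σ
    apply map_xiHom_injective M ω σ
    rw [← toFixedVertex_value, ← toFixedVertex_value, h]
  · intro u
    refine ⟨fun σ => M.map (xiIso ω σ).inv.op (u (op σ.orb) σ.value), ?_⟩
    funext H x
    exact (map_xiHom_inv M ω ⟨H.unop, eqSimplex x⟩ _).trans
      (congrArg (u H) (value_eqSimplex (A := H.unop) x))

theorem toFixedVertex_mem_iff {n : ℕ} (f : AllCochains M n) :
    toFixedVertex M ω n f ∈ OCochains (v.M₀ M) (Phi X) n ↔ f ∈ SCochains M n := by
  have hd : ∀ σ : EqSimp X n, toFixedVertex M ω n f (op σ.orb) σ.value = 0 ↔ f σ = 0 := fun σ => by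
    rw [toFixedVertex_value]
    exact map_eq_zero_iff (M.map (xiHom v ω σ).op).hom (map_xiHom_injective M ω σ)
  have hn : ∀ (τ : EqSimp X n) (A : OrbitCat G) (g : A ⟶ τ.orb),
      toFixedVertex M ω n f (op A) (((Phi X).map g.op).app (op ⦋n⦌) τ.value) =
        (v.M₀ M).map g.op (toFixedVertex M ω n f (op τ.orb) τ.value) ↔
      f (τ.pre g) = M.map (τ.preHom g).op (f τ) := fun τ A g => by
    have e : (v.M₀ M).map g.op (toFixedVertex M ω n f (op τ.orb) τ.value) =
        M.map (xiHom v ω (τ.pre g)).op (M.map (τ.preHom g).op (f τ)) := by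
      rw [toFixedVertex_value, ← Functor.map_comp_apply, ← op_comp, ← functor_map_xiHom]
      exact (Functor.map_comp_apply M _ _ _).symm
    rw [e, value_pre]
    refine (Eq.congr_left (toFixedVertex_value M ω f (τ.pre g))).trans ?_
    exact (map_xiHom_injective M ω (τ.pre g)).eq_iff
  constructor
  · intro h
    exact ⟨fun σ hσ => (hd σ).mp (h.1 _ _ hσ), fun τ A g => (hn τ A g).mp (h.2 _ _ g.op _)⟩
  · intro h
    refine ⟨fun H x hx => ?_, fun K H g x => ?_⟩
    · have hx' := value_eqSimplex (A := H.unop) x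
      rw [← hx'] at hx ⊢
      exact (hd ⟨H.unop, eqSimplex x⟩).mpr (h.1 ⟨H.unop, eqSimplex x⟩ hx)
    · have hx' := value_eqSimplex (A := K.unop) x
      have := (hn ⟨K.unop, eqSimplex x⟩ H.unop g.unop).mpr (h.2 _ _ _)
      rw [hx'] at this
      exact this

theorem toFixedVertex_coboundary {n : ℕ} (f : AllCochains M n) :
    toFixedVertex M ω (n + 1) (coboundary M n f) =
      oCoboundary (v.action M) ω.theta n (toFixedVertex M ω n f) := by
  have key : ∀ σ : EqSimp X (n + 1),
      toFixedVertex M ω (n + 1) (coboundary M n f) (op σ.orb) σ.value =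
      twistedD ((v.action M).act (op σ.orb)) (wBarApp ω.theta (op σ.orb))
        (toFixedVertex M ω n f (op σ.orb)) σ.value := by
    intro σ
    have h0 : twistedFace ((v.action M).act (op σ.orb)) (wBarApp ω.theta (op σ.orb))
        (toFixedVertex M ω n f (op σ.orb)) 0 σ.value =
        M.map (xiHom v ω σ).op (M.map σ.star.op (f (σ.face 0))) := by
      -- One inverse comes from the twisted face and the other from the action `α · m = M(b(α))⁻¹
      -- m`; together they leave `M` of the loop itself, as in `xiHom_face_zero`.
      have hl : (edgeElt (wBarApp ω.theta (op σ.orb)) σ.value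
          (Fin.zero_le ((0 : Fin (n + 2)).succAbove 0)))⁻¹⁻¹ = ω.loop σ.map 0 1 :=
        (inv_inv _).trans (congrArg (fun s => ω.loop s 0 1) (eqSimplex_value σ))
      have h1 := toFixedVertex_value M ω f (σ.face 0)
      rw [← Functor.map_comp_apply, ← op_comp, xiHom_face_zero]
      refine Eq.trans ?_ (Functor.map_comp_apply M (xiHom v ω (σ.face 0)).op
        (v.loopHom σ.orb (ω.loop σ.map 0 1)).op (f (σ.face 0))).symm
      rw [← h1, ← hl]
      rfl
    have hs : ∀ j : Fin (n + 1), toFixedVertex M ω n f (op σ.orb) (σ.face j.succ).value =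
        M.map (xiHom v ω σ).op
          (M.map (eqToHom (σ.initial_face_succ j)).op (f (σ.face j.succ))) := fun j => by
      rw [← Functor.map_comp_apply, ← op_comp, xiHom_face_succ]
      exact toFixedVertex_value M ω f (σ.face j.succ)
    rw [toFixedVertex_value]
    refine Eq.trans ?_ (twistedD_eq _ _ _ _).symm
    refine (map_add (M.map (xiHom v ω σ).op).hom _ _).trans (congrArg₂ _ h0.symm ?_)
    refine (map_sum (M.map (xiHom v ω σ).op).hom _ _).trans (Finset.sum_congr rfl fun j _ => ?_)
    exact (map_zsmul (M.map (xiHom v ω σ).op).hom _ _).trans (congrArg _ (hs j).symm)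
  funext H x
  have hx := value_eqSimplex (A := H.unop) x
  have := key ⟨H.unop, eqSimplex x⟩
  rw [hx] at this
  exact this

theorem toFixedVertex_mem_cocycles_iff {n : ℕ} (f : AllCochains M n) :
    toFixedVertex M ω n f ∈ OCocycles (v.action M) ω.theta n ↔ f ∈ SCocycles M n := by
  refine and_congr (toFixedVertex_mem_iff M ω f) ?_
  refine Iff.trans ?_ (map_eq_zero_iff (toFixedVertex M ω (n + 1))
    (toFixedVertex_bijective M ω (n + 1)).1)
  rw [toFixedVertex_coboundary]
  rfl

theorem toFixedVertex_mem_coboundaries_iff {n : ℕ} (f : AllCochains M n) :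
    toFixedVertex M ω n f ∈ OCoboundaries (v.action M) ω.theta n ↔ f ∈ SCoboundaries M n := by
  cases n with
  | zero => exact map_eq_zero_iff (toFixedVertex M ω 0) (toFixedVertex_bijective M ω 0).1
  | succ n =>
    constructor
    · rintro ⟨u, hu, e⟩
      obtain ⟨g, rfl⟩ := (toFixedVertex_bijective M ω n).2 u
      refine ⟨g, (toFixedVertex_mem_iff M ω g).mp hu, (toFixedVertex_bijective M ω (n + 1)).1 ?_⟩
      rw [toFixedVertex_coboundary, e]
    · rintro ⟨g, hg, rfl⟩
      exact ⟨_, (toFixedVertex_mem_iff M ω g).mpr hg, (toFixedVertex_coboundary M ω g).symm⟩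

end Comparison

/-! ### Existence of path systems -/

section Paths

theorem joined_of_edge {Y : SSet.{u}} {x y : Y _⦋0⦌} (e : SSet.Edge x y) :
    Joined (pt x) (pt y) := by
  have hp : ∀ i j : Fin 2, i ≠ j → pt (Y.δ i e.edge) = cell e.edge (stdSimplex.vertex j) := by
    intro i j hij
    refine (cell_map (SimplexCategory.δ i) e.edge (stdSimplex.vertex 0)).trans ?_
    rw [stdSimplex.map_vertex]
    refine congrArg (fun k => cell e.edge (stdSimplex.vertex k)) ?_
    revert i j
    decide
  have hx : pt x = cell e.edge (stdSimplex.vertex 0) := by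
    rw [← hp 1 0 (by decide), e.src_eq]
  have hy : pt y = cell e.edge (stdSimplex.vertex 1) := by
    rw [← hp 0 1 (by decide), e.tgt_eq]
  exact ⟨((seg 0 1).map (cell e.edge).continuous).cast hx hy⟩

theorem joined_of_isConnected {Y : SSet.{u}} (hY : Y.IsConnected) (x y : Y _⦋0⦌) :
    Joined (pt x) (pt y) := by
  have h := (SSet.π₀.mk_eq_mk_iff x y).mp (Subsingleton.elim _ _)
  induction h with
  | rel x y h => exact joined_of_edge h.some
  | refl x => exact Joined.refl _
  | symm x y _ ih => exact ih.symm
  | trans x y z _ _ ih ih' => exact ih.trans ih'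

theorem map_pt {Y Z : SSet.{u}} (f : Y ⟶ Z) (x : Y _⦋0⦌) :
    SSet.toTop.map f (pt x) = pt (f.app _ x) := map_cell f x _

variable {G : Type u} [Group G] {X : Action SSet.{u} G}

theorem smul_pt (g : G) (x : X.V _⦋0⦌) : g • (pt x : Realiz X) = pt (g • x) :=
  map_pt (X.ρ g : X.V ⟶ X.V) x

theorem smul_realization_fixed {H : Subgroup G} {g : G} (hg : g ∈ H)
    (y : SSet.toTop.obj (fixedSub X H : SSet.{u})) :
    g • (SSet.toTop.map (fixedSub X H).ι y : Realiz X) = SSet.toTop.map (fixedSub X H).ι y := by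
  have h : (fixedSub X H).ι ≫ (X.ρ g : X.V ⟶ X.V) = (fixedSub X H).ι := by
    apply NatTrans.ext; funext n
    apply ConcreteCategory.hom_ext; intro x
    exact x.2 g hg
  change SSet.toTop.map (X.ρ g : X.V ⟶ X.V) (SSet.toTop.map (fixedSub X H).ι y) = _
  conv_rhs => rw [← h]
  rw [Functor.map_comp]
  rfl

/-- In a `G`-connected `G`-simplicial set, every vertex is joined to a fixed vertex by a path
fixed by its stabilizer. -/
theorem exists_fixed_path (hX : GConnected X) (v : FixedVertex X) (x : X.V _⦋0⦌) :
    ∃ p : Path (pt v.v : Realiz X) (pt x), ∀ (g : G), g • x = x → ∀ t, g • p t = p t := by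
  -- Both `x` and `v` are vertices of `X^H`. A path in its realization maps to a path in `|X|` that
  -- is pointwise fixed by `H`.
  let H := MulAction.stabilizer G x
  let v' : (fixedSub X H : SSet.{u}) _⦋0⦌ := ⟨v.v, fun h _ => v.fixed h⟩
  let x' : (fixedSub X H : SSet.{u}) _⦋0⦌ := ⟨x, fun h hh => hh⟩
  obtain ⟨p⟩ := joined_of_isConnected (hX H) v' x'
  have hv : (pt v.v : Realiz X) = SSet.toTop.map (fixedSub X H).ι (pt v') :=
    (map_pt (fixedSub X H).ι v').symm
  have hx : (pt x : Realiz X) = SSet.toTop.map (fixedSub X H).ι (pt x') :=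
    (map_pt (fixedSub X H).ι x').symm
  refine ⟨(p.map (SSet.toTop.map (fixedSub X H).ι).hom.continuous).cast hv hx, fun g hg t => ?_⟩
  exact smul_realization_fixed (H := H) hg (p t)

theorem nonempty_pathSystem (hX : GConnected X) (v : FixedVertex X) : Nonempty (PathSystem v) := by
  choose p hp using exists_fixed_path hX v
  let r : X.V _⦋0⦌ → X.V _⦋0⦌ := fun x =>
    (Quotient.mk (MulAction.orbitRel G (X.V _⦋0⦌)) x).out
  have hr : ∀ x, ∃ g : G, g • r x = x := fun x =>
    (Quotient.exact (Quotient.out_eq (Quotient.mk (MulAction.orbitRel G (X.V _⦋0⦌)) x)).symm)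
  choose k hk using hr
  have hv : ∀ g : G, g • (pt v.v : Realiz X) = pt v.v := fun g => by rw [smul_pt, v.fixed]
  -- The path of the orbit representative `r x`, moved by a chosen `k x` with `k x • r x = x`. It
  -- still starts at `v` because `v` is fixed.
  let q : ∀ x : X.V _⦋0⦌, Path (pt v.v : Realiz X) (pt x) := fun x =>
    ((p (r x)).map (continuous_const_smul (k x))).cast (hv _).symm
      (by rw [smul_pt, hk])
  have hq : ∀ x t, q x t = k x • p (r x) t := fun x t => rfl
  have he : ∀ (g : G) x t, q (g • x) t = g • q x t := by
    intro g x t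
    have hrg : r (g • x) = r x := congrArg Quotient.out
      (Quotient.sound (s := MulAction.orbitRel G (X.V _⦋0⦌)) ⟨g, rfl⟩)
    -- The two translates to `g • x` differ by an element of the stabilizer of `r x`, which fixes
    -- the chosen path; hence the choice of `k` does not matter.
    have hs : ((g * k x)⁻¹ * k (g • x)) • r x = r x := by
      have := hk (g • x)
      rw [hrg] at this
      rw [mul_smul, this, inv_smul_eq_iff, mul_smul, hk]
    have e := hp (r x) _ hs t
    rw [hq, hq, hrg, smul_smul]
    rw [mul_smul, inv_smul_eq_iff] at e
    exact e
  refine ⟨⟨q, fun x g hg t => ?_, he⟩⟩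
  rw [← he, hg]

end Paths

/-! ### The classification of liftings -/

section Classification

variable {G : Type u} [Group G] {X : Action SSet.{u} G} {v : FixedVertex X} (M : LocalCoeff X)
  (ω : PathSystem v)

/-- The twisted cocycle of a lifting of `θ(κ)`. -/
def Lifting.cochain {n : ℕ} (F : Lifting v M ω n) :
    ∀ H : (OrbitCat G)ᵒᵖ, ((Phi X).obj H) _⦋n⦌ → (v.M₀ M).obj H :=
  pullFundamental (v.action M) F.1

theorem verticallyHomotopic_iff {n : ℕ} (F F' : Lifting v M ω n) :
    VerticallyHomotopic v M ω n F F' ↔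
      F'.cochain - F.cochain ∈ OCoboundaries (v.action M) ω.theta n :=
  ⟨HomotopicOver.sub_mem (v.action M) (θ := ω.theta),
    HomotopicOver.of_sub_mem (v.action M) F.2 F'.2⟩

/-- Being cohomologous is congruence modulo a subgroup, so no horn filling in `L_φ(M₀, n)` is
needed. -/
theorem verticallyHomotopic_equivalence (n : ℕ) : Equivalence (VerticallyHomotopic v M ω n) where
  refl F := by
    rw [verticallyHomotopic_iff, sub_self]
    exact zero_mem _
  symm {F F'} h := by
    rw [verticallyHomotopic_iff] at h ⊢
    rw [← neg_sub]
    exact neg_mem h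
  trans {F F' F''} h h' := by
    rw [verticallyHomotopic_iff] at h h' ⊢
    rw [← sub_add_sub_cancel]
    exact add_mem h' h

/-- The lifting of `θ(κ)` belonging to an equivariant cocycle. -/
def liftingOfCocycle {n : ℕ} (f : SCocycles M n) : Lifting v M ω n :=
  ⟨liftOfCocycle (v.action M)
    ⟨toFixedVertex M ω n f.1, (toFixedVertex_mem_cocycles_iff M ω f.1).mpr f.2⟩, rfl⟩

theorem cochain_liftingOfCocycle {n : ℕ} (f : SCocycles M n) :
    (liftingOfCocycle M ω f).cochain = toFixedVertex M ω n f.1 :=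
  pullFundamental_liftOfCocycle (v.action M) _

theorem lifting_eq_iff {n : ℕ} (f : SCocycles M n) (F : Lifting v M ω n) :
    liftingOfCocycle M ω f = F ↔ toFixedVertex M ω n f.1 = F.cochain := by
  rw [← cochain_liftingOfCocycle]
  exact ⟨fun h => by rw [h], fun h => Subtype.ext
    (lifting_ext (v.action M) (liftingOfCocycle M ω f).2 F.2 h)⟩

theorem verticallyHomotopic_liftingOfCocycle_iff {n : ℕ} (f g : SCocycles M n) :
    VerticallyHomotopic v M ω n (liftingOfCocycle M ω f) (liftingOfCocycle M ω g) ↔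
      -f + g ∈ (SCoboundaries M n).addSubgroupOf (SCocycles M n) := by
  rw [verticallyHomotopic_iff, cochain_liftingOfCocycle, cochain_liftingOfCocycle, ← map_sub,
    toFixedVertex_mem_coboundaries_iff, AddSubgroup.mem_addSubgroupOf, sub_eq_neg_add]
  rfl

/-- The map from cohomology to vertical homotopy classes of liftings. -/
def classify (n : ℕ) (c : BICohomology M n) : VerticalClasses v M ω n :=
  Quotient.liftOn' c (fun f => Quot.mk _ (liftingOfCocycle M ω f)) fun f g h =>
    Quot.sound ((verticallyHomotopic_liftingOfCocycle_iff M ω f g).mpr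
      (QuotientAddGroup.leftRel_apply.mp h))

theorem classify_bijective (n : ℕ) : Function.Bijective (classify M ω n) := by
  constructor
  · intro c d
    obtain ⟨f, rfl⟩ := QuotientAddGroup.mk_surjective c
    obtain ⟨g, rfl⟩ := QuotientAddGroup.mk_surjective d
    intro h
    -- Equality in `Quot` yields only the generated equivalence relation, which here is vertical
    -- homotopy itself.
    have h' := (verticallyHomotopic_equivalence M ω n).eqvGen_iff.mp (Quot.eqvGen_exact h)
    exact QuotientAddGroup.eq.mpr ((verticallyHomotopic_liftingOfCocycle_iff M ω f g).mp h')
  · rintro ⟨F⟩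
    obtain ⟨f, hf⟩ := (toFixedVertex_bijective M ω n).2 F.cochain
    have hm := pullFundamental_mem (v.action M) F.2
    have hfm : f ∈ SCocycles M n := (toFixedVertex_mem_cocycles_iff M ω f).mp (by rw [hf]; exact hm)
    exact ⟨QuotientAddGroup.mk ⟨f, hfm⟩,
      congrArg (Quot.mk _) ((lifting_eq_iff M ω ⟨f, hfm⟩ F).mpr hf)⟩

end Classification

end

end EquivCoh

theorem theorem5p11 {G : Type u} [Group G] (X : Action SSet.{u} G)
    (hX : EquivCoh.GConnected X) (v : EquivCoh.FixedVertex X) (M : EquivCoh.LocalCoeff X) :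
    Nonempty (EquivCoh.PathSystem v) ∧
    ∀ (ω : EquivCoh.PathSystem v) (n : ℕ),
      Equivalence (EquivCoh.VerticallyHomotopic v M ω n) ∧
      ∃ e : EquivCoh.BICohomology M n ≃ EquivCoh.VerticalClasses v M ω n,
        ∀ (f : EquivCoh.SCocycles M n) (F : EquivCoh.Lifting v M ω n),
          (∀ σ : EquivCoh.EqSimp X n,
            EquivCoh.fundamental (v.action M) n (Opposite.op σ.orb)
              ((F.1.app (Opposite.op σ.orb)).app (Opposite.op (SimplexCategory.mk n)) σ.value) =
            M.map (EquivCoh.xiHom v ω σ).op (f.1 σ)) →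
          e (QuotientAddGroup.mk f) = Quot.mk _ F := by
  refine ⟨EquivCoh.nonempty_pathSystem hX v, fun ω n =>
    ⟨EquivCoh.verticallyHomotopic_equivalence M ω n,
      Equiv.ofBijective _ (EquivCoh.classify_bijective M ω n), fun f F h => ?_⟩⟩
  -- The hypothesis prescribes the whole fundamental cochain of `F`, so `F` equals the lifting built
  -- from `f`, not merely up to homotopy.
  refine congrArg (Quot.mk _) ((EquivCoh.lifting_eq_iff M ω f F).mpr ?_)
  funext H x
  have e := (EquivCoh.toFixedVertex_value M ω f.1 ⟨H.unop, EquivCoh.eqSimplex x⟩).trans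
    (h ⟨H.unop, EquivCoh.eqSimplex x⟩).symm
  rw [EquivCoh.value_eqSimplex (A := H.unop) x] at e
  exact e
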